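/- Let $\lambda,\mu,\delta$ be real numbers with $0<\lambda<1$, $\mu>0$ and $1-\lambda<\delta<d_{\lambda,\mu}$, where $d_{\lambda,\mu}=1$ if $\lambda\mu<1$ and $d_{\lambda,\mu}=\frac{\mu-\lambda\mu}{\mu-1}$ if $\lambda\mu\ge 1$. Let $I=[0,1)$, $\eta=\frac{1-\delta}{\lambda}$, and let $f:I\to I$ be the map with $f(x)=\lambda x+\delta$ for $0\le x<\eta$ and $f(x)=\mu(\lambda x+\delta-1)$ for $\eta\le x<1$. Let $F:\mathbb R\to\mathbb R$ be its lift, $F(x)=f(\{x\})+\lfloor x\rfloor$ if $\{x\}<\eta$ and $F(x)=f(\{x\})+\lfloor x\rfloor+1$ if $\{x\}\ge\eta$, and let $\rho=\lim_{k\to\infty}F^k(x)/k$ be the rotation number of $f$ (the limit exists and does not depend on $x\in\mathbb R$). Assume that $\rho$ is irrational. Then the series in the following definition of $\phi:\mathbb R\to\mathbb R$ converges for every $y\in\mathbb R$: $$\phi(y)=\lfloor y\rfloor+\frac{1-\delta}{\lambda}+\sum_{k\ge 0}\lambda^k\mu^{\lfloor y\rfloor-\lfloor y-k\rho\rfloor}\Bigl(\frac{\lambda+\delta-1}{\lambda}+\lfloor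 y-(k+1)\rho\rfloor-\lfloor y-k\rho\rfloor\Bigr).$$ For every integer $l\ge 1$ put $\xi_l=\phi(\{l\rho\})$, and let $\xi_l^-=\phi(\{l\rho\}^-)$ be the left limit of $\phi$ at $\{l\rho\}$, which exists. Then $0<\xi_l^-<\xi_l<1$ for all $l\ge1$, the intervals $[\xi_l^-,\xi_l]$, $l\ge 1$, are pairwise disjoint, and for every integer $n\ge 1$ one has the decomposition $$f^n(I)=I\setminus\bigcup_{l=1}^n[\xi_l^-,\xi_l).$$ For every $l\ge 1$ one has $$\xi_l=f^l(0)=\frac{1-\delta}{\lambda}+\sum_{k=0}^{l}\lambda^{l-k}\mu^{\lfloor l\rho\rfloor-\lfloor k\rho\rfloor}\Bigl(\frac{\lambda+\delta-1}{\lambda}+\lfloor (k-1)\rho\rfloor-\lfloor k\rho\rfloor\Bigr),$$ $$\xi_l^-=f^l(1^-)=f^l(0)-\lambda^{l-1}\mu^{\lfloor l\rho\rfloor}\bigl(\delta-\mu(\lambda+\delta-1)\bigr),$$ where $f^l(1^-)$ is the left limit of $f^l$ at $1$. Moreover $$C:=\bigcap_{n\ge 1}f^n(I)=\phi(I)=I\setminus\bigcup_{l\ge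 1}[\xi_l^-,\xi_l),\qquad \overline C=\overline{\phi(I)}=[0,1]\setminus\bigcup_{l\ge 1}(\xi_l^-,\xi_l),$$ and $\overline C$ has Lebesgue measure $0$ and is homeomorphic to the Cantor set. -/

import Mathlib

open Set Filter Topology MeasureTheory

namespace TwoIntervalMap

/-- The upper bound `d_{λ,μ}` for the parameter `δ`. -/
noncomputable def dBound (lam μ : ℝ) : ℝ :=
  if lam * μ < 1 then 1 else (μ - lam * μ) / (μ - 1)

/-- The critical point `η = (1 - δ) / λ`. -/
noncomputable def eta (lam δ : ℝ) : ℝ := (1 - δ) / lam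

/-- The map `f = f_{λ,μ,δ}`, given by its two affine formulas. It is only used on `I = [0, 1)`,
which it maps into itself (`mapsTo_f` below). -/
noncomputable def f (lam μ δ : ℝ) (x : ℝ) : ℝ :=
  if x < eta lam δ then lam * x + δ else μ * (lam * x + δ - 1)

/-- The lift `F = F_{λ,μ,δ} : ℝ → ℝ` of `f`. -/
noncomputable def lift (lam μ δ : ℝ) (x : ℝ) : ℝ :=
  if Int.fract x < eta lam δ then lam * x + δ + (1 - lam) * ⌊x⌋
  else μ * (lam * x + δ - 1) + 1 + (1 - lam * μ) * ⌊x⌋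

/-- The rotation number `ρ_{λ,μ,δ} = lim_k F^k(x) / k`. The limit exists for every starting point
`x` and does not depend on it (`tendsto_rotationNumber` below). -/
noncomputable def rotationNumber (lam μ δ : ℝ) : ℝ :=
  limUnder atTop (fun k : ℕ => (lift lam μ δ)^[k] 0 / k)

/-- The `k`-th term of the series defining `φ(y)`. -/
noncomputable def phiTerm (lam μ δ ρ y : ℝ) (k : ℕ) : ℝ :=
  lam ^ k * μ ^ (⌊y⌋ - ⌊y - k * ρ⌋) *
    ((lam + δ - 1) / lam + ⌊y - (k + 1) * ρ⌋ - ⌊y - k * ρ⌋)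

/-- The function `φ = φ_{λ,μ,δ,ρ} : ℝ → ℝ`. -/
noncomputable def phi (lam μ δ ρ : ℝ) (y : ℝ) : ℝ :=
  ⌊y⌋ + (1 - δ) / lam + ∑' k : ℕ, phiTerm lam μ δ ρ y k

/-- `ξ_l = φ({lρ})`. -/
noncomputable def xi (lam μ δ ρ : ℝ) (l : ℕ) : ℝ :=
  phi lam μ δ ρ (Int.fract (l * ρ))

/-- `ξ_l⁻ = φ({lρ}⁻)`, the left limit of `φ` at `{lρ}`. -/
noncomputable def xiMinus (lam μ δ ρ : ℝ) (l : ℕ) : ℝ :=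
  Function.leftLim (phi lam μ δ ρ) (Int.fract (l * ρ))

/-- The limit set `C = ⋂_{n ≥ 1} f^n(I)`. -/
def limitSet (lam μ δ : ℝ) : Set ℝ :=
  ⋂ n ∈ Ici (1 : ℕ), (f lam μ δ)^[n] '' Ico 0 1

theorem param_bounds {lam μ δ : ℝ} (h0 : 0 < lam) (h1 : lam < 1)
    (hδ1 : 1 - lam < δ) (hδ2 : δ < dBound lam μ) : δ < 1 ∧ μ * (lam + δ - 1) < δ := by
  unfold dBound at hδ2
  split_ifs at hδ2 with h
  · refine ⟨hδ2, ?_⟩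
    rcases le_total μ 1 with hm | hm
    · have : μ * (lam + δ - 1) ≤ 1 * (lam + δ - 1) :=
        mul_le_mul_of_nonneg_right hm (by linarith)
      linarith
    · nlinarith
  · push Not at h
    have hm : 0 < μ - 1 := by nlinarith
    rw [lt_div_iff₀ hm] at hδ2
    constructor <;> nlinarith

/-- `f` maps `I = [0, 1)` into itself. -/
theorem mapsTo_f {lam μ δ : ℝ} (h0 : 0 < lam) (h1 : lam < 1) (hμ : 0 < μ)
    (hδ1 : 1 - lam < δ) (hδ2 : δ < dBound lam μ) :
    MapsTo (f lam μ δ) (Ico 0 1) (Ico 0 1) := by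
  obtain ⟨hd, hj⟩ := param_bounds h0 h1 hδ1 hδ2
  rintro x ⟨hx0, hx1⟩
  have hle : lam * eta lam δ = 1 - δ := by unfold eta; field_simp
  unfold f
  split_ifs with h
  · constructor <;> nlinarith
  · push Not at h
    constructor
    · have : 0 ≤ lam * x + δ - 1 := by nlinarith
      positivity
    · have : μ * (lam * x) < μ * lam := by
        have : lam * x < lam * 1 := by nlinarith
        nlinarith
      nlinarith

theorem lift_eq (lam μ δ x : ℝ) : lift lam μ δ x = ⌊x⌋ +
    (if Int.fract x < eta lam δ then lam * Int.fract x + δ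
      else μ * (lam * Int.fract x + δ - 1) + 1) := by
  have hx : Int.fract x = x - ⌊x⌋ := rfl
  unfold lift
  split_ifs <;> rw [hx] <;> ring

theorem lift_add_one (lam μ δ x : ℝ) : lift lam μ δ (x + 1) = lift lam μ δ x + 1 := by
  rw [lift_eq, lift_eq]
  simp only [Int.fract_add_one, Int.floor_add_one]
  push_cast
  ring

theorem monotone_lift {lam μ δ : ℝ} (h0 : 0 < lam) (h1 : lam < 1) (hμ : 0 < μ)
    (hδ1 : 1 - lam < δ) (hδ2 : δ < dBound lam μ) : Monotone (lift lam μ δ) := by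
  obtain ⟨hd, hj⟩ := param_bounds h0 h1 hδ1 hδ2
  have hle : lam * eta lam δ = 1 - δ := by unfold eta; field_simp
  intro x y hxy
  rw [lift_eq, lift_eq]
  have hx0 := Int.fract_nonneg x
  have hx1 := Int.fract_lt_one x
  have hy0 := Int.fract_nonneg y
  have hfx := Int.floor_add_fract x
  have hfy := Int.floor_add_fract y
  have hlo : ∀ t : ℝ, eta lam δ ≤ t → 0 ≤ μ * (lam * t + δ - 1) := fun t ht =>
    mul_nonneg hμ.le (by nlinarith)
  rcases (Int.floor_mono hxy).lt_or_eq with h | h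
  · have h' : (⌊x⌋ : ℝ) + 1 ≤ ⌊y⌋ := by exact_mod_cast h
    have hA : (if Int.fract x < eta lam δ then lam * Int.fract x + δ
        else μ * (lam * Int.fract x + δ - 1) + 1) ≤ 1 + δ := by
      split_ifs with hx
      · nlinarith
      · have : μ * (lam * Int.fract x + δ - 1) ≤ μ * (lam + δ - 1) :=
          mul_le_mul_of_nonneg_left (by nlinarith) hμ.le
        linarith
    have hB : δ ≤ (if Int.fract y < eta lam δ then lam * Int.fract y + δ
        else μ * (lam * Int.fract y + δ - 1) + 1) := by
      split_ifs with hy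
      · nlinarith
      · have := hlo _ (not_lt.1 hy)
        linarith
    linarith
  · rw [← h] at hfy ⊢
    have hxy' : Int.fract x ≤ Int.fract y := by linarith
    have hm : lam * Int.fract x ≤ lam * Int.fract y := mul_le_mul_of_nonneg_left hxy' h0.le
    gcongr (⌊x⌋ : ℝ) + ?_
    split_ifs with hx hy hy
    · linarith
    · have := hlo _ (not_lt.1 hy)
      nlinarith
    · exact absurd (lt_of_le_of_lt hxy' hy) hx
    · have : μ * (lam * Int.fract x + δ - 1) ≤ μ * (lam * Int.fract y + δ - 1) :=
        mul_le_mul_of_nonneg_left (by linarith) hμ.le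
      linarith

/-- The rotation number is a limit along every orbit of the lift. -/
theorem tendsto_rotationNumber {lam μ δ : ℝ} (h0 : 0 < lam) (h1 : lam < 1) (hμ : 0 < μ)
    (hδ1 : 1 - lam < δ) (hδ2 : δ < dBound lam μ) (x : ℝ) :
    Tendsto (fun k : ℕ => (lift lam μ δ)^[k] x / k) atTop (𝓝 (rotationNumber lam μ δ)) := by
  let G : CircleDeg1Lift :=
    ⟨⟨lift lam μ δ, monotone_lift h0 h1 hμ hδ1 hδ2⟩, lift_add_one lam μ δ⟩
  have key : ∀ y : ℝ, Tendsto (fun k : ℕ => (lift lam μ δ)^[k] y / k) atTop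
      (𝓝 G.translationNumber) := by
    intro y
    have h := G.tendsto_translationNumber y
    have h2 : Tendsto (fun k : ℕ => y / (k : ℝ)) atTop (𝓝 0) :=
      tendsto_const_div_atTop_nhds_zero_nat y
    have h3 := h.add h2
    rw [add_zero] at h3
    refine h3.congr fun k => ?_
    rw [CircleDeg1Lift.coe_pow, ← add_div, sub_add_cancel]
    rfl
  have : rotationNumber lam μ δ = G.translationNumber := (key 0).limUnder_eq
  rw [this]
  exact key x

end TwoIntervalMap

/-! In the coordinate `coord`, of slope μ^(-m) on [m, m+1), both branches of the lift get slope λ,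
and the lift becomes X ↦ λX + `shift` ⌊x⌋. The orbit of 0 has the same integer parts as nρ. Solving
this recursion along the backward orbit of the translation by ρ gives the series `conj`, with conj(y
+ ρ) = λ conj(y) + shift ⌊y⌋; Abel summation identifies it with φ on [0, 1).

Two points need an argument. Convergence rests on λμ^ρ < 1 (`lam_mul_rpow_lt_one`): otherwise the
forward images of the gap I \ f(I), disjoint modulo 1, would have lengths bounded below. The
normalization conj(0) = 0 (`conj_zero`) holds because the orbit of 0 follows conj({nρ}) with an
error tending to 0, and would leave [0, 1) for any other value.

It follows that `conj` sends the breakpoint 1 - ρ of the rotation to η and semiconjugates the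
rotation to f (`f_conj`). It is strictly increasing and right-continuous, with jumps exactly at the
points lρ + m, l ≥ 1; the jump at {lρ} is the gap [ξ_l⁻, ξ_l). A point enters gap l + 1 only from
gap l (`f_mem_gap_iff`), so f^n(I) loses exactly the first n gaps. The gap lengths add up to conj(1)
- conj(0) = 1 (`hasSum_gaps`), so the closure is null and any two of its points are separated by a
gap. It is also perfect, hence a Cantor set. -/

/-! ### A characterization of the Cantor space. -/

/-- A compact Hausdorff space without isolated points whose points are separated by countably many
clopen sets is homeomorphic to the Cantor space. -/
theorem nonempty_homeomorph_nat_bool {X : Type*} [TopologicalSpace X] [CompactSpace X]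
    [PerfectSpace X] [Nonempty X] (U : ℕ → Set X) (hU : ∀ n, IsClopen (U n))
    (hsep : ∀ x y, x ≠ y → ∃ n, ¬(x ∈ U n ↔ y ∈ U n)) : Nonempty (X ≃ₜ (ℕ → Bool)) := by
  classical
  have hsplit : ∀ (A : Set X) (n : ℕ), ∃ B : Set X, IsClopen A → A.Nonempty →
      IsClopen B ∧ (A ∩ B).Nonempty ∧ (A \ B).Nonempty ∧
      ∀ x ∈ A, ∀ y ∈ A, (x ∈ B ↔ y ∈ B) → (x ∈ U n ↔ y ∈ U n) := by
    intro A n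
    -- If `U n` cuts `A`, it serves as `B`. Otherwise it is constant on `A`, the last clause is
    -- automatic, and perfectness gives a second point of `A`, hence some `U k` cutting `A`.
    by_cases h : (A ∩ U n).Nonempty ∧ (A \ U n).Nonempty
    · exact ⟨U n, fun _ _ => ⟨hU n, h.1, h.2, fun _ _ _ _ => id⟩⟩
    by_cases hA : IsClopen A ∧ A.Nonempty
    · obtain ⟨hAc, x, hx⟩ := hA
      have hp : Preperfect A := hAc.isOpen.preperfect
      obtain ⟨y, hy, hyx⟩ := preperfect_iff_nhds.1 hp x hx univ univ_mem
      obtain ⟨k, hk⟩ := hsep x y hyx.symm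
      refine ⟨U k, fun _ _ => ⟨hU k, ?_, ?_, ?_⟩⟩
      · by_cases hxk : x ∈ U k
        · exact ⟨x, hx, hxk⟩
        · exact ⟨y, hy.2, by tauto⟩
      · by_cases hxk : x ∈ U k
        · exact ⟨y, hy.2, by tauto⟩
        · exact ⟨x, hx, hxk⟩
      · intro u hu v hv _
        by_contra hne
        refine h ?_
        by_cases hun : u ∈ U n
        · exact ⟨⟨u, hu, hun⟩, ⟨v, hv, by tauto⟩⟩
        · exact ⟨⟨v, hv, by tauto⟩, ⟨u, hu, hun⟩⟩
    · exact ⟨univ, fun h1 h2 => absurd ⟨h1, h2⟩ hA⟩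
  choose B hB using hsplit
  -- `cell x n` consists of the points with the same first n binary digits as x. Each cell is split
  -- again, so every finite code occurs; the n-th split decides `U n`, so codes separate points.
  let cell : X → ℕ → Set X := fun x n =>
    Nat.rec univ (fun n A => {y ∈ A | y ∈ B A n ↔ x ∈ B A n}) n
  let code : X → ℕ → Bool := fun x n => decide (x ∈ B (cell x n) n)
  have cell_succ : ∀ x n, cell x (n + 1) =
      {y ∈ cell x n | y ∈ B (cell x n) n ↔ x ∈ B (cell x n) n} := fun _ _ => rfl
  have mem_cell : ∀ x n, x ∈ cell x n := by
    intro x n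
    induction n with
    | zero => exact mem_univ x
    | succ n ih => rw [cell_succ]; exact ⟨ih, Iff.rfl⟩
  have clopen_cell : ∀ x n, IsClopen (cell x n) := by
    intro x n
    induction n with
    | zero => exact isClopen_univ
    | succ n ih =>
      have hb := (hB _ n ih ⟨x, mem_cell x n⟩).1
      rw [cell_succ]
      by_cases hx : x ∈ B (cell x n) n
      · simp only [hx, iff_true]
        exact ih.inter hb
      · simp only [hx, iff_false]
        exact ih.inter hb.compl
  have cell_eq : ∀ n x y, y ∈ cell x n → cell y n = cell x n := by
    intro n
    induction n with
    | zero => exact fun _ _ _ => rfl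
    | succ n ih =>
      intro x y hy
      rw [cell_succ] at hy
      rw [cell_succ, cell_succ, ih x y hy.1]
      simp only [hy.2]
  have cell_anti : ∀ x n, cell x (n + 1) ⊆ cell x n := fun x n => by
    rw [cell_succ]; exact sep_subset _ _
  have code_eq : ∀ n x y, y ∈ cell x (n + 1) → code y n = code x n := by
    intro n x y hy
    have h1 := cell_eq n x y (cell_anti x n hy)
    rw [cell_succ] at hy
    simp only [code, h1, hy.2]
  have code_eq_lt : ∀ n x y, y ∈ cell x n → ∀ i < n, code y i = code x i := by
    intro n x y hy i hi
    have : cell x n ⊆ cell x (i + 1) := antitone_nat_of_succ_le (cell_anti x) hi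
    exact code_eq i x y (this hy)
  have code_cont : Continuous code := by
    refine continuous_pi fun n => IsLocallyConstant.continuous ?_
    rw [IsLocallyConstant.iff_eventually_eq]
    intro x
    filter_upwards [(clopen_cell x (n + 1)).isOpen.mem_nhds (mem_cell x (n + 1))] with y hy
    exact code_eq n x y hy
  have code_inj : Function.Injective code := by
    intro x y hxy
    have hall : ∀ n, y ∈ cell x n := by
      intro n
      induction n with
      | zero => exact mem_univ y
      | succ n ih =>
        have h1 := congrFun hxy n
        simp only [code, cell_eq n x y ih, decide_eq_decide] at h1
        rw [cell_succ]
        exact ⟨ih, h1.symm⟩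
    by_contra hne
    obtain ⟨n, hn⟩ := hsep x y hne
    have h1 := hall (n + 1)
    rw [cell_succ] at h1
    exact hn ((hB _ n (clopen_cell x n) ⟨x, mem_cell x n⟩).2.2.2 x (mem_cell x n) y h1.1 h1.2.symm)
  have code_surj : Function.Surjective code := by
    intro b
    have hne : ∀ n, {x | ∀ i < n, code x i = b i}.Nonempty := by
      intro n
      induction n with
      | zero => exact ⟨Classical.arbitrary X, by simp⟩
      | succ n ih =>
        obtain ⟨x, hx⟩ := ih
        obtain ⟨-, ⟨u, hu, hub⟩, ⟨v, hv, hvb⟩, -⟩ :=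
          hB _ n (clopen_cell x n) ⟨x, mem_cell x n⟩
        have key : ∃ y ∈ cell x n, code y n = b n := by
          cases hbn : b n with
          | true => exact ⟨u, hu, by simp only [code, cell_eq n x u hu, hub, decide_true]⟩
          | false => exact ⟨v, hv, by simp only [code, cell_eq n x v hv, hvb, decide_false]⟩
        obtain ⟨y, hy, hyn⟩ := key
        refine ⟨y, fun i hi => ?_⟩
        rcases Nat.lt_succ_iff_lt_or_eq.1 hi with h | rfl
        · rw [code_eq_lt n x y hy i h, hx i h]
        · exact hyn
    have hcl : ∀ n, IsClosed {x | ∀ i < n, code x i = b i} := by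
      intro n
      simp only [ofPred_forall]
      exact isClosed_iInter fun i => isClosed_iInter fun _ =>
        isClosed_eq ((continuous_apply i).comp code_cont) continuous_const
    obtain ⟨x, hx⟩ := IsCompact.nonempty_iInter_of_sequence_nonempty_isCompact_isClosed
      (fun n => {x | ∀ i < n, code x i = b i})
      (fun n x hx i hi => hx i (hi.trans n.lt_succ_self)) hne (hcl 0).isCompact hcl
    refine ⟨x, funext fun n => ?_⟩
    exact mem_iInter.1 hx (n + 1) n n.lt_succ_self
  exact ⟨Continuous.homeoOfEquivCompactToT2 (f := Equiv.ofBijective code ⟨code_inj, code_surj⟩)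
    code_cont⟩

/-! ### Density of irrational rotation orbits. -/

/-- Steps shorter than an interval cannot jump over it. -/
theorem exists_nat_mul_add_int_mem_Ioo {θ a b : ℝ} (hθ : 0 < θ) (hab : θ < b - a) (L : ℕ) :
    ∃ t : ℕ, L ≤ t ∧ ∃ m : ℤ, t * θ + m ∈ Ioo a b := by
  have h1 := Int.floor_le (a - L * θ)
  -- Starting this far to the left of a forces at least L steps before a is passed.
  set M : ℤ := ⌊a - L * θ⌋ with hM
  have hL : (L : ℝ) ≤ (a - M) / θ := by rw [le_div_iff₀ hθ]; linarith
  have h2 := Nat.floor_le (a := (a - M) / θ) ((Nat.cast_nonneg L).trans hL)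
  have h3 := Nat.lt_floor_add_one ((a - M) / θ)
  rw [div_lt_iff₀ hθ] at h3
  rw [le_div_iff₀ hθ] at h2
  refine ⟨⌊(a - M) / θ⌋₊ + 1, (Nat.le_floor hL).trans (Nat.le_succ _), M, ?_, ?_⟩
  · push_cast; linarith
  · push_cast; linarith

/-- The forward orbits of an irrational rotation are dense. -/
theorem Irrational.exists_nat_mul_add_int_mem_Ioo {ρ : ℝ} (hirr : Irrational ρ) {a b : ℝ}
    (hab : a < b) (L : ℕ) : ∃ l : ℕ, L ≤ l ∧ ∃ m : ℤ, l * ρ + m ∈ Ioo a b := by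
  obtain ⟨N, hN⟩ := exists_nat_one_div_lt (sub_pos.2 hab)
  -- Dirichlet approximation gives a step kρ - j shorter than b - a, nonzero by irrationality; a
  -- negative step is handled by reflecting the interval.
  obtain ⟨j, k, hk, -, hjk⟩ := Real.exists_int_int_abs_mul_sub_le ρ N.succ_pos
  lift k to ℕ using hk.le
  have hk1 : 1 ≤ k := by exact_mod_cast hk
  have hlt : |(k : ℝ) * ρ - j| < b - a := by
    refine lt_of_le_of_lt hjk (lt_of_le_of_lt ?_ hN)
    push_cast
    exact one_div_le_one_div_of_le (by positivity) (by linarith)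
  have hne : (k : ℝ) * ρ - j ≠ 0 := ((hirr.natCast_mul (by omega)).sub_intCast j).ne_zero
  obtain ⟨t, hLt, M, hM⟩ : ∃ t : ℕ, L ≤ t ∧ ∃ M : ℤ, t * ((k : ℝ) * ρ - j) + M ∈ Ioo a b := by
    rcases hne.lt_or_gt with hn | hp
    · rw [abs_of_neg hn] at hlt
      obtain ⟨t, hLt, M, hM⟩ := _root_.exists_nat_mul_add_int_mem_Ioo (a := -b) (b := -a)
        (neg_pos.2 hn) (by linarith) L
      refine ⟨t, hLt, -M, ?_, ?_⟩
      · push_cast; linarith [hM.2]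
      · push_cast; linarith [hM.1]
    · rw [abs_of_pos hp] at hlt
      exact _root_.exists_nat_mul_add_int_mem_Ioo hp hlt L
  refine ⟨t * k, hLt.trans (Nat.le_mul_of_pos_right t hk1), M - t * j, ?_⟩
  convert hM using 1
  push_cast; ring

/-! ### The coordinate of constant slope λ. -/

namespace TwoIntervalMap

/-- Admissible parameters whose rotation number `ρ` is irrational. -/
structure IrrationalParams (lam μ δ ρ : ℝ) : Prop where
  lam_pos : 0 < lam
  lam_lt_one : lam < 1
  mu_pos : 0 < μ
  one_sub_lt : 1 - lam < δ
  lt_dBound : δ < dBound lam μ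
  rho_eq : ρ = rotationNumber lam μ δ
  irrational : Irrational ρ

/-- The length of the gap `I \ f(I)`. -/
def jump (lam μ δ : ℝ) : ℝ := δ - μ * (lam + δ - 1)

/-- The values at the integers of the coordinate `coord`. -/
noncomputable def scale (μ : ℝ) (m : ℤ) : ℝ :=
  if μ = 1 then m else (1 - μ ^ (-m)) / (1 - μ⁻¹)

/-- A piecewise affine coordinate, of slope `μ ^ (-m)` on `[m, m + 1)`, in which the lift of `f`
has slope `λ` everywhere. -/
noncomputable def coord (μ x : ℝ) : ℝ := scale μ ⌊x⌋ + μ ^ (-⌊x⌋) * Int.fract x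

/-- The translation part, on `[m, m + 1)`, of the lift of `f` in the coordinate `coord`. -/
noncomputable def shift (lam μ δ : ℝ) (m : ℤ) : ℝ := (1 - lam) * scale μ m + μ ^ (-m) * δ

@[simp] theorem scale_zero (μ : ℝ) : scale μ 0 = 0 := by simp [scale]

theorem scale_add_one {μ : ℝ} (hμ : 0 < μ) (m : ℤ) : scale μ (m + 1) = scale μ m + μ ^ (-m) := by
  unfold scale
  split_ifs with h
  · simp [h]
  · have h1 : μ - 1 ≠ 0 := sub_ne_zero.2 h
    have h2 : 1 - μ⁻¹ = (μ - 1) / μ := by field_simp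
    rw [neg_add, zpow_add₀ hμ.ne', h2, zpow_neg_one]
    field_simp
    ring

theorem coord_of_mem_Ico {μ x : ℝ} (hx : x ∈ Ico (0 : ℝ) 1) : coord μ x = x := by
  have h : ⌊x⌋ = 0 := Int.floor_eq_zero_iff.2 hx
  have h2 : Int.fract x = x := Int.fract_eq_self.2 hx
  rw [coord, h, h2]
  simp

/-- These increments are the source of all gap lengths: they become the jumps of `conj`. -/
theorem shift_add_one_sub {lam μ δ : ℝ} (hμ : 0 < μ) (m : ℤ) :
    shift lam μ δ (m + 1) - shift lam μ δ m = μ ^ (-m - 1) * jump lam μ δ := by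
  have h : μ ^ (-m) = μ ^ (-m - 1) * μ := by
    rw [← zpow_add_one₀ hμ.ne']; congr 1; ring
  have h2 : -(m + 1) = -m - 1 := by ring
  rw [shift, shift, scale_add_one hμ, h2, h, jump]
  ring

theorem shift_add_one {lam μ δ : ℝ} (hμ : 0 < μ) (m : ℤ) :
    shift lam μ δ (m + 1) = 1 - lam + shift lam μ δ m / μ := by
  have h : scale μ (m + 1) = 1 + scale μ m / μ := by
    unfold scale
    split_ifs with h
    · simp [h, add_comm]
    · have h1 : μ - 1 ≠ 0 := sub_ne_zero.2 h
      have h2 : 1 - μ⁻¹ = (μ - 1) / μ := by field_simp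
      rw [neg_add, zpow_add₀ hμ.ne', h2, zpow_neg_one]
      field_simp
      ring
  rw [shift, shift, h, neg_add, zpow_add₀ hμ.ne', zpow_neg_one]
  field_simp
  ring

@[simp] theorem shift_zero (lam μ δ : ℝ) : shift lam μ δ 0 = δ := by simp [shift]

namespace IrrationalParams

variable {lam μ δ ρ : ℝ}

theorem delta_lt_one (h : IrrationalParams lam μ δ ρ) : δ < 1 :=
  (param_bounds h.lam_pos h.lam_lt_one h.one_sub_lt h.lt_dBound).1

theorem jump_pos (h : IrrationalParams lam μ δ ρ) : 0 < jump lam μ δ :=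
  sub_pos.2 (param_bounds h.lam_pos h.lam_lt_one h.one_sub_lt h.lt_dBound).2

theorem delta_pos (h : IrrationalParams lam μ δ ρ) : 0 < δ := by
  linarith [h.lam_lt_one, h.one_sub_lt]

theorem lam_mul_eta (h : IrrationalParams lam μ δ ρ) : lam * eta lam δ = 1 - δ := by
  have := h.lam_pos
  unfold eta; field_simp

theorem eta_pos (h : IrrationalParams lam μ δ ρ) : 0 < eta lam δ :=
  div_pos (by linarith [h.delta_lt_one]) h.lam_pos

theorem eta_lt_one (h : IrrationalParams lam μ δ ρ) : eta lam δ < 1 := by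
  rw [eta, div_lt_one h.lam_pos]
  linarith [h.one_sub_lt]

theorem image_one_pos (h : IrrationalParams lam μ δ ρ) : 0 < μ * (lam + δ - 1) :=
  mul_pos h.mu_pos (by linarith [h.one_sub_lt])

theorem strictMono_shift (h : IrrationalParams lam μ δ ρ) : StrictMono (shift lam μ δ) :=
  strictMono_int_of_lt_succ fun m => by
    have h1 := shift_add_one_sub (lam := lam) (δ := δ) h.mu_pos m
    have h2 : 0 < μ ^ (-m - 1) * jump lam μ δ := mul_pos (zpow_pos h.mu_pos _) h.jump_pos
    linarith

/-- The second branch lands one unit interval higher, where the slope of the coordinate is divided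
by μ; this cancels the factor μ of that branch. -/
theorem coord_lift (h : IrrationalParams lam μ δ ρ) (x : ℝ) :
    coord μ (lift lam μ δ x) = lam * coord μ x + shift lam μ δ ⌊x⌋ := by
  have hx0 := Int.fract_nonneg x
  have hx1 := Int.fract_lt_one x
  have hη := h.lam_mul_eta
  have hl := h.lam_pos
  have hm := h.mu_pos
  have hj := h.jump_pos
  have hd := h.delta_lt_one
  have hd0 := h.delta_pos
  unfold jump at hj
  rw [lift_eq]
  split_ifs with hx
  · have hs : lam * Int.fract x + δ ∈ Ico (0 : ℝ) 1 := by constructor <;> nlinarith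
    have h1 : ⌊(⌊x⌋ : ℝ) + (lam * Int.fract x + δ)⌋ = ⌊x⌋ := by
      rw [Int.floor_intCast_add, Int.floor_eq_zero_iff.2 hs, add_zero]
    have h2 : Int.fract ((⌊x⌋ : ℝ) + (lam * Int.fract x + δ)) = lam * Int.fract x + δ := by
      rw [Int.fract_intCast_add, Int.fract_eq_self.2 hs]
    rw [coord, h1, h2, coord, shift]
    ring
  · have hle : μ * (lam * Int.fract x + δ - 1) ≤ μ * (lam + δ - 1) :=
      mul_le_mul_of_nonneg_left (by nlinarith) hm.le
    have hs : μ * (lam * Int.fract x + δ - 1) ∈ Ico (0 : ℝ) 1 :=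
      ⟨mul_nonneg hm.le (by nlinarith), by linarith⟩
    have h0 : (⌊x⌋ : ℝ) + (μ * (lam * Int.fract x + δ - 1) + 1) =
        ((⌊x⌋ + 1 : ℤ) : ℝ) + μ * (lam * Int.fract x + δ - 1) := by push_cast; ring
    have h1 : ⌊((⌊x⌋ + 1 : ℤ) : ℝ) + μ * (lam * Int.fract x + δ - 1)⌋ = ⌊x⌋ + 1 := by
      rw [Int.floor_intCast_add, Int.floor_eq_zero_iff.2 hs, add_zero]
    have h2 : Int.fract (((⌊x⌋ + 1 : ℤ) : ℝ) + μ * (lam * Int.fract x + δ - 1)) =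
        μ * (lam * Int.fract x + δ - 1) := by
      rw [Int.fract_intCast_add, Int.fract_eq_self.2 hs]
    rw [h0, coord, h1, h2, coord, shift, scale_add_one hm, neg_add, zpow_add₀ hm.ne', zpow_neg_one]
    field_simp
    ring

/-! ### Comparison of orbits with the translation by ρ. -/

/-- The lift of `f` as a bundled lift of degree one. -/
noncomputable def circleLift (h : IrrationalParams lam μ δ ρ) : CircleDeg1Lift :=
  ⟨⟨lift lam μ δ, monotone_lift h.lam_pos h.lam_lt_one h.mu_pos h.one_sub_lt h.lt_dBound⟩,
    lift_add_one lam μ δ⟩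

theorem coe_circleLift_pow (h : IrrationalParams lam μ δ ρ) (n : ℕ) :
    ⇑(h.circleLift ^ n) = (lift lam μ δ)^[n] := CircleDeg1Lift.coe_pow _ n

theorem translationNumber_circleLift (h : IrrationalParams lam μ δ ρ) :
    h.circleLift.translationNumber = ρ := by
  refine Eq.trans ?_ h.rho_eq.symm
  refine tendsto_nhds_unique h.circleLift.tendsto_translation_number₀ ?_
  simp only [coe_circleLift_pow]
  exact tendsto_rotationNumber h.lam_pos h.lam_lt_one h.mu_pos h.one_sub_lt h.lt_dBound 0

theorem add_int_lt_iterate (h : IrrationalParams lam μ δ ρ) {n : ℕ} {m : ℤ}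
    (hm : (m : ℝ) < n * ρ) (x : ℝ) : x + m < (lift lam μ δ)^[n] x := by
  rw [← h.coe_circleLift_pow]
  apply CircleDeg1Lift.lt_map_of_int_lt_translationNumber
  rwa [CircleDeg1Lift.translationNumber_pow, h.translationNumber_circleLift]

theorem iterate_lt_add_int (h : IrrationalParams lam μ δ ρ) {n : ℕ} {m : ℤ}
    (hm : n * ρ < (m : ℝ)) (x : ℝ) : (lift lam μ δ)^[n] x < x + m := by
  rw [← h.coe_circleLift_pow]
  apply CircleDeg1Lift.map_lt_of_translationNumber_lt_int
  rwa [CircleDeg1Lift.translationNumber_pow, h.translationNumber_circleLift]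

theorem lift_add_int (h : IrrationalParams lam μ δ ρ) (n : ℕ) (x : ℝ) (m : ℤ) :
    (lift lam μ δ)^[n] (x + m) = (lift lam μ δ)^[n] x + m := by
  rw [← h.coe_circleLift_pow]
  exact CircleDeg1Lift.map_add_int _ x m

theorem monotone_iterate (h : IrrationalParams lam μ δ ρ) (n : ℕ) :
    Monotone (lift lam μ δ)^[n] :=
  (monotone_lift h.lam_pos h.lam_lt_one h.mu_pos h.one_sub_lt h.lt_dBound).iterate n

theorem natCast_mul_ne_intCast (h : IrrationalParams lam μ δ ρ) {n : ℕ} (hn : n ≠ 0) (m : ℤ) :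
    (n : ℝ) * ρ ≠ m := (h.irrational.natCast_mul hn).ne_int m

theorem floor_lt (h : IrrationalParams lam μ δ ρ) {n : ℕ} (hn : n ≠ 0) :
    (⌊(n : ℝ) * ρ⌋ : ℝ) < n * ρ :=
  (Int.floor_le _).lt_of_ne (h.natCast_mul_ne_intCast hn _).symm

theorem rho_pos (h : IrrationalParams lam μ δ ρ) : 0 < ρ := by
  have h1 : ((0 : ℤ) : ℝ) ≤ h.circleLift.translationNumber := by
    apply CircleDeg1Lift.le_translationNumber_of_add_int_le (x := 0)
    change _ ≤ lift lam μ δ 0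
    rw [lift_eq]
    simp [h.eta_pos, h.delta_pos.le]
  rw [h.translationNumber_circleLift, Int.cast_zero] at h1
  exact h1.lt_of_ne h.irrational.ne_zero.symm

theorem rho_lt_one (h : IrrationalParams lam μ δ ρ) : ρ < 1 := by
  have h1 : h.circleLift.translationNumber ≤ ((1 : ℤ) : ℝ) := by
    apply CircleDeg1Lift.translationNumber_le_of_le_add_int (x := 0)
    change lift lam μ δ 0 ≤ _
    rw [lift_eq]
    simp [h.eta_pos, h.delta_lt_one.le]
  rw [h.translationNumber_circleLift, Int.cast_one] at h1
  exact h1.lt_of_ne h.irrational.ne_one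

theorem floor_le_iterate (h : IrrationalParams lam μ δ ρ) {x : ℝ} (hx : 0 ≤ x) (n : ℕ) :
    (⌊(n : ℝ) * ρ⌋ : ℝ) ≤ (lift lam μ δ)^[n] x := by
  rcases eq_or_ne n 0 with rfl | hn
  · simpa using hx
  · linarith [h.add_int_lt_iterate (h.floor_lt hn) x]

/-- Makes the itinerary of 0 explicit: the translation part used at step n is `shift` at ⌊nρ⌋. -/
theorem floor_iterate_zero (h : IrrationalParams lam μ δ ρ) (n : ℕ) :
    ⌊(lift lam μ δ)^[n] 0⌋ = ⌊(n : ℝ) * ρ⌋ := by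
  refine Int.floor_eq_iff.2 ⟨h.floor_le_iterate le_rfl n, ?_⟩
  have := h.iterate_lt_add_int (n := n) (m := ⌊(n : ℝ) * ρ⌋ + 1)
    (by push_cast; exact Int.lt_floor_add_one _) 0
  push_cast at this
  linarith

/-! ### The inequality λμ^ρ < 1. -/

/-- Each step multiplies the difference by λ and adds a difference of shifts, which is nonnegative
by monotonicity. -/
theorem le_coord_iterate_sub (h : IrrationalParams lam μ δ ρ) {x y : ℝ} (hxy : x ≤ y) (n : ℕ) :
    lam ^ n * (coord μ y - coord μ x) ≤
      coord μ ((lift lam μ δ)^[n] y) - coord μ ((lift lam μ δ)^[n] x) := by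
  induction n with
  | zero => simp
  | succ n ih =>
    rw [Function.iterate_succ_apply', Function.iterate_succ_apply', h.coord_lift, h.coord_lift]
    have h1 := h.strictMono_shift.monotone (Int.floor_mono (h.monotone_iterate n hxy))
    have h2 := mul_le_mul_of_nonneg_left ih h.lam_pos.le
    rw [pow_succ']
    linarith

end IrrationalParams

/-- For μ ≥ 1 the slopes μ^(-m) do not increase with m, so the slope at x bounds all those to its
right. -/
theorem coord_sub_le {μ : ℝ} (hμ : 1 ≤ μ) {x y : ℝ} (hxy : x ≤ y) :
    coord μ y - coord μ x ≤ μ ^ (-⌊x⌋) * (y - x) := by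
  have hμ0 : 0 < μ := by linarith
  have key : ∀ k : ℤ, ⌊x⌋ ≤ k → scale μ k - scale μ ⌊x⌋ ≤ μ ^ (-⌊x⌋) * (k - ⌊x⌋) := by
    intro k hk
    induction k, hk using Int.leInduction with
    | base => simp
    | succ k hk ih =>
      rw [scale_add_one hμ0]
      have : μ ^ (-k) ≤ μ ^ (-⌊x⌋) := zpow_le_zpow_right₀ hμ (by omega)
      push_cast
      linarith
  have hf := Int.floor_mono hxy
  have h1 := key ⌊y⌋ hf
  have h2 : μ ^ (-⌊y⌋) ≤ μ ^ (-⌊x⌋) := zpow_le_zpow_right₀ hμ (by omega)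
  have h3 := mul_le_mul_of_nonneg_right h2 (Int.fract_nonneg y)
  have h4 : μ ^ (-⌊x⌋) * (y - x) = μ ^ (-⌊x⌋) * (⌊y⌋ - ⌊x⌋) + μ ^ (-⌊x⌋) * Int.fract y
      - μ ^ (-⌊x⌋) * Int.fract x := by
    rw [Int.fract, Int.fract]; ring
  rw [coord, coord, h4]
  linarith

namespace IrrationalParams

variable {lam μ δ ρ : ℝ}

/-- The orbits of the two ends of the gap stay apart as long as `λ μ^ρ ≥ 1`. -/
theorem iterate_add_le_iterate (h : IrrationalParams lam μ δ ρ) (hμ : 1 ≤ μ)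
    (hr : 1 ≤ lam * μ ^ ρ) (n : ℕ) :
    (lift lam μ δ)^[n] (μ * (lam + δ - 1)) + jump lam μ δ / μ ≤ (lift lam μ δ)^[n] δ := by
  have hm := h.mu_pos
  have hj := h.jump_pos
  have hlt : μ * (lam + δ - 1) < δ := sub_pos.1 hj
  have h1 := h.le_coord_iterate_sub hlt.le n
  rw [coord_of_mem_Ico ⟨h.image_one_pos.le, hlt.trans h.delta_lt_one⟩,
    coord_of_mem_Ico ⟨h.delta_pos.le, h.delta_lt_one⟩] at h1
  have hmono := h.monotone_iterate n hlt.le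
  have h2 := coord_sub_le hμ hmono
  -- Replacing the floor by nρ - 1 costs one factor μ, which is why the separation is `jump / μ`.
  have h3 : μ ^ (-⌊(lift lam μ δ)^[n] (μ * (lam + δ - 1))⌋) ≤ μ ^ (1 - n * ρ) := by
    rw [← Real.rpow_intCast]
    refine Real.rpow_le_rpow_of_exponent_le hμ ?_
    have h4 : (⌊(n : ℝ) * ρ⌋ : ℝ) ≤ ⌊(lift lam μ δ)^[n] (μ * (lam + δ - 1))⌋ := by
      exact_mod_cast Int.le_floor.2 (h.floor_le_iterate h.image_one_pos.le n)
    have h5 := Int.lt_floor_add_one ((n : ℝ) * ρ)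
    push_cast
    linarith
  have h6 := mul_le_mul_of_nonneg_right h3 (sub_nonneg.2 hmono)
  have h7 : μ ^ (1 - n * ρ) = μ * ((μ ^ ρ) ^ n)⁻¹ := by
    rw [Real.rpow_sub hm, Real.rpow_one, mul_comm (n : ℝ) ρ, Real.rpow_mul hm.le,
      Real.rpow_natCast, div_eq_mul_inv]
  rw [h7] at h6
  have hpos : 0 < (μ ^ ρ) ^ n := by positivity
  have h8 : 1 ≤ lam ^ n * (μ ^ ρ) ^ n := by
    rw [← mul_pow]; exact one_le_pow₀ hr
  set d := (lift lam μ δ)^[n] δ - (lift lam μ δ)^[n] (μ * (lam + δ - 1)) with hd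
  have h9 : lam ^ n * jump lam μ δ ≤ μ * ((μ ^ ρ) ^ n)⁻¹ * d := by
    refine le_trans ?_ h6
    exact h1.trans h2
  have h10 : jump lam μ δ ≤ μ * d := by
    have h11 := mul_le_mul_of_nonneg_right h9 hpos.le
    have h12 : μ * ((μ ^ ρ) ^ n)⁻¹ * d * (μ ^ ρ) ^ n = μ * d := by field_simp
    rw [h12] at h11
    have h13 : lam ^ n * jump lam μ δ * (μ ^ ρ) ^ n =
      (lam ^ n * (μ ^ ρ) ^ n) * jump lam μ δ := by ring
    rw [h13] at h11
    nlinarith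
  have h14 : jump lam μ δ / μ ≤ d := by
    rw [div_le_iff₀ hm]; linarith
  linarith

/-- Modulo the integer ⌊x⌋ the lift takes values in [δ, 1 + μ(λ+δ-1)), all of whose integer
translates miss the gap. This makes the gap a wandering interval. -/
theorem lift_add_int_notMem_gap (h : IrrationalParams lam μ δ ρ) (x : ℝ) (m : ℤ) :
    lift lam μ δ x + m < μ * (lam + δ - 1) ∨ δ ≤ lift lam μ δ x + m := by
  have hx0 := Int.fract_nonneg x
  have hx1 := Int.fract_lt_one x
  have hη := h.lam_mul_eta
  have hl := h.lam_pos
  have hm := h.mu_pos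
  have hj : μ * (lam + δ - 1) < δ := sub_pos.1 h.jump_pos
  have hd := h.delta_lt_one
  have hp := h.image_one_pos
  have key : δ ≤ lift lam μ δ x - ⌊x⌋ ∧ lift lam μ δ x - ⌊x⌋ < 1 + μ * (lam + δ - 1) := by
    rw [lift_eq]
    split_ifs with hx
    · constructor <;> nlinarith
    · have h1 : μ * (lam * Int.fract x + δ - 1) < μ * (lam + δ - 1) :=
        mul_lt_mul_of_pos_left (by nlinarith) hm
      have h2 : 0 ≤ μ * (lam * Int.fract x + δ - 1) := mul_nonneg hm.le (by nlinarith)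
      constructor <;> linarith
  rcases lt_or_ge (⌊x⌋ + m) 0 with hlt | hge
  · left
    have : (⌊x⌋ : ℝ) + m ≤ -1 := by exact_mod_cast (by omega : ⌊x⌋ + m ≤ -1)
    linarith [key.2]
  · right
    have : (0 : ℝ) ≤ (⌊x⌋ : ℝ) + m := by exact_mod_cast hge
    linarith [key.1]

/-- For μ ≥ 1, if the product were at least 1, the points F^n(δ) would be the right ends of disjoint
intervals modulo 1 of length at least c; compactness forbids infinitely many. -/
theorem lam_mul_rpow_lt_one (h : IrrationalParams lam μ δ ρ) : lam * μ ^ ρ < 1 := by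
  rcases le_total μ 1 with hμ | hμ
  · have := Real.rpow_le_one h.mu_pos.le hμ h.rho_pos.le
    nlinarith [h.lam_pos, h.lam_lt_one]
  by_contra! hr
  set c := jump lam μ δ / μ with hc
  have hcpos : 0 < c := div_pos h.jump_pos h.mu_pos
  have hgap := h.iterate_add_le_iterate hμ hr
  rw [← hc] at hgap
  have hlt : μ * (lam + δ - 1) < δ := sub_pos.1 h.jump_pos
  have hsep : ∀ n k : ℕ, n < k → ∀ m : ℤ,
      c ≤ |(lift lam μ δ)^[k] δ + m - (lift lam μ δ)^[n] δ| := by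
    intro n k hnk m
    obtain ⟨j, rfl⟩ := Nat.exists_eq_add_of_lt hnk
    have hstep : ∀ x, (lift lam μ δ)^[n + j + 1] x + m =
        (lift lam μ δ)^[n] ((lift lam μ δ)^[j + 1] x + m) := fun x => by
      rw [h.lift_add_int, ← Function.iterate_add_apply, add_assoc]
    have hmiss : ∀ x, (lift lam μ δ)^[j + 1] x + m < μ * (lam + δ - 1) ∨
        δ ≤ (lift lam μ δ)^[j + 1] x + m := fun x => by
      rw [Function.iterate_succ_apply']; exact h.lift_add_int_notMem_gap _ m
    -- The sign of (j+1)ρ + m says on which side of itself an end of the gap returns; since the gap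
    -- is missed, the return lies beyond the other end, and monotonicity transports this by F^n.
    have hne := h.natCast_mul_ne_intCast j.succ_ne_zero (-m)
    rcases hne.lt_or_gt with hn | hp
    · have h1 := h.iterate_lt_add_int hn δ
      push_cast at h1
      have h2 := (hmiss δ).resolve_right (by linarith)
      have h3 := h.monotone_iterate n h2.le
      rw [← hstep] at h3
      rw [abs_sub_comm]
      refine le_trans ?_ (le_abs_self _)
      linarith [hgap n]
    · have h1 := h.add_int_lt_iterate hp (μ * (lam + δ - 1))
      push_cast at h1
      have h2 := (hmiss (μ * (lam + δ - 1))).resolve_left (by linarith)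
      have h3 := h.monotone_iterate n h2
      rw [← hstep] at h3
      refine le_trans ?_ (le_abs_self _)
      linarith [hgap (n + j + 1)]
  obtain ⟨a, -, φ, hφ, hlim⟩ := isCompact_Icc.tendsto_subseq (s := Icc (0 : ℝ) 1)
    (x := fun n => Int.fract ((lift lam μ δ)^[n] δ))
    (fun n => ⟨Int.fract_nonneg _, (Int.fract_lt_one _).le⟩)
  obtain ⟨N, hN⟩ := Metric.cauchySeq_iff.1 hlim.cauchySeq c hcpos
  have h1 := hN (N + 1) N.le_succ N le_rfl
  -- This integer turns the difference of iterates into a difference of fractional parts.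
  have h2 := hsep (φ N) (φ (N + 1)) (hφ N.lt_succ_self)
    (⌊(lift lam μ δ)^[φ N] δ⌋ - ⌊(lift lam μ δ)^[φ (N + 1)] δ⌋)
  rw [Real.dist_eq] at h1
  refine absurd h1 (not_lt.2 (h2.trans (le_of_eq ?_)))
  simp only [Function.comp_apply, Int.fract]
  push_cast
  congr 1
  ring

/-! ### Convergence of the series. -/

theorem summable_pow_mul_zpow (h : IrrationalParams lam μ δ ρ) (e : ℕ → ℤ) (C : ℝ)
    (he : ∀ k : ℕ, |(e k : ℝ) - k * ρ| ≤ C) : Summable fun k => lam ^ k * μ ^ (e k) := by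
  have hm := h.mu_pos
  have hl := h.lam_pos
  -- Compare with the geometric series of ratio λμ^ρ; adding μ^C and μ^(-C) covers both μ ≥ 1 and μ
  -- ≤ 1.
  have hb : ∀ k, lam ^ k * μ ^ (e k) ≤ (μ ^ C + μ ^ (-C)) * (lam * μ ^ ρ) ^ k := by
    intro k
    have h1 : μ ^ (e k) = (μ ^ ρ) ^ k * μ ^ ((e k : ℝ) - k * ρ) := by
      rw [← Real.rpow_natCast, ← Real.rpow_mul hm.le, ← Real.rpow_add hm, ← Real.rpow_intCast]
      congr 1; ring
    have h2 : μ ^ ((e k : ℝ) - k * ρ) ≤ μ ^ C + μ ^ (-C) := by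
      obtain ⟨ha, hb⟩ := abs_le.1 (he k)
      rcases le_total 1 μ with hμ | hμ
      · have := Real.rpow_le_rpow_of_exponent_le hμ hb
        have : 0 < μ ^ (-C) := Real.rpow_pos_of_pos hm _
        linarith
      · have := Real.rpow_le_rpow_of_exponent_ge hm hμ ha
        have : 0 < μ ^ C := Real.rpow_pos_of_pos hm _
        linarith
    rw [h1, mul_pow, ← mul_assoc, mul_comm (_ + _)]
    exact mul_le_mul_of_nonneg_left h2 (by positivity)
  refine Summable.of_nonneg_of_le (fun k => by positivity) hb (Summable.mul_left _ ?_)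
  exact summable_geometric_of_lt_one (by positivity) h.lam_mul_rpow_lt_one

theorem summable_pow_mul_zpow_neg_floor (h : IrrationalParams lam μ δ ρ) (y : ℝ) :
    Summable fun k : ℕ => lam ^ k * μ ^ (-⌊y - k * ρ⌋) := by
  refine h.summable_pow_mul_zpow _ (|y| + 1) fun k => ?_
  have h1 := Int.floor_le (y - k * ρ)
  have h2 := Int.lt_floor_add_one (y - k * ρ)
  have h3 := abs_le.1 (le_refl |y|)
  push_cast
  rw [abs_le]
  constructor <;> linarith

theorem summable_pow_mul_zpow_floor (h : IrrationalParams lam μ δ ρ) :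
    Summable fun k : ℕ => lam ^ k * μ ^ ⌊(k : ℝ) * ρ⌋ := by
  refine h.summable_pow_mul_zpow _ 1 fun k => ?_
  have h1 := Int.floor_le (k * ρ)
  have h2 := Int.lt_floor_add_one (k * ρ)
  rw [abs_le]
  constructor <;> linarith

theorem summable_pow_mul_scale (h : IrrationalParams lam μ δ ρ) (y : ℝ) :
    Summable fun k : ℕ => lam ^ k * scale μ ⌊y - k * ρ⌋ := by
  have hg : Summable fun k : ℕ => lam ^ k :=
    summable_geometric_of_lt_one h.lam_pos.le h.lam_lt_one
  by_cases hμ : μ = 1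
  · have hg1 : Summable fun k : ℕ => (k : ℝ) * lam ^ k := by
      have := summable_pow_mul_geometric_of_norm_lt_one 1 (r := lam)
        (by rw [Real.norm_of_nonneg h.lam_pos.le]; exact h.lam_lt_one)
      simpa using this
    refine Summable.of_norm_bounded ((hg1.mul_left ρ).add (hg.mul_left (|y| + 1))) fun k => ?_
    have h1 := Int.floor_le (y - k * ρ)
    have h2 := Int.lt_floor_add_one (y - k * ρ)
    have h3 := abs_le.1 (le_refl |y|)
    have h4 : 0 ≤ k * ρ := mul_nonneg k.cast_nonneg h.rho_pos.le
    have h5 : |(⌊y - k * ρ⌋ : ℝ)| ≤ k * ρ + |y| + 1 := by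
      rw [abs_le]; constructor <;> linarith
    have h6 : 0 ≤ lam ^ k := pow_nonneg h.lam_pos.le k
    rw [scale, if_pos hμ, Real.norm_eq_abs, abs_mul, abs_of_nonneg h6]
    nlinarith [mul_le_mul_of_nonneg_left h5 h6]
  · have := ((hg.sub (h.summable_pow_mul_zpow_neg_floor y)).div_const (1 - μ⁻¹))
    refine this.congr fun k => ?_
    rw [scale, if_neg hμ]
    ring

theorem summable_pow_mul_shift (h : IrrationalParams lam μ δ ρ) (y : ℝ) :
    Summable fun k : ℕ => lam ^ k * shift lam μ δ ⌊y - k * ρ⌋ := by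
  refine (((h.summable_pow_mul_scale y).mul_left (1 - lam)).add
    ((h.summable_pow_mul_zpow_neg_floor y).mul_right δ)).congr fun k => ?_
  rw [shift]
  ring

end IrrationalParams
end TwoIntervalMap

/-! ### The semiconjugacy and its functional equations. -/

namespace TwoIntervalMap

theorem _root_.HasSum.of_eq {f g : ℕ → ℝ} {a b : ℝ} (hg : HasSum g b) (hf : ∀ k, f k = g k)
    (hab : a = b) : HasSum f a := by
  rw [hab, funext hf]; exact hg

/-- The semiconjugacy between the translation by `ρ` and the lift of `f`, in the coordinate
`coord`. -/
noncomputable def conj (lam μ δ ρ y : ℝ) : ℝ := ∑' k : ℕ, lam ^ k * shift lam μ δ ⌊y - (k + 1) * ρ⌋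

/-- The left limit of `conj`. -/
noncomputable def conjLeft (lam μ δ ρ y : ℝ) : ℝ :=
  ∑' k : ℕ, lam ^ k * shift lam μ δ (⌈y - (k + 1) * ρ⌉ - 1)

namespace IrrationalParams

variable {lam μ δ ρ : ℝ}

theorem summable_conj (h : IrrationalParams lam μ δ ρ) (y : ℝ) :
    Summable fun k : ℕ => lam ^ k * shift lam μ δ ⌊y - (k + 1) * ρ⌋ := by
  refine (h.summable_pow_mul_shift (y - ρ)).congr fun k => ?_
  rw [show y - ρ - k * ρ = y - (k + 1) * ρ by ring]

theorem hasSum_conj (h : IrrationalParams lam μ δ ρ) (y : ℝ) :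
    HasSum (fun k : ℕ => lam ^ k * shift lam μ δ ⌊y - (k + 1) * ρ⌋) (conj lam μ δ ρ y) :=
  (h.summable_conj y).hasSum

theorem floor_sub_rho (h : IrrationalParams lam μ δ ρ) (x : ℝ) :
    ⌊x - ρ⌋ = ⌊x⌋ ∨ ⌊x - ρ⌋ = ⌊x⌋ - 1 := by
  have h1 : ⌊x - ρ⌋ ≤ ⌊x⌋ := Int.floor_mono (by linarith [h.rho_pos])
  have h2 : ⌊x⌋ - 1 ≤ ⌊x - ρ⌋ := by
    rw [Int.le_floor]
    push_cast
    linarith [h.rho_lt_one, Int.floor_le x]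
  omega

/-- Abel summation turns the series defining `φ` into the one defining `conj`. -/
theorem pow_mul_zpow_mul_eq (h : IrrationalParams lam μ δ ρ) (y : ℝ) (k : ℕ) :
    lam ^ k * μ ^ (-⌊y - k * ρ⌋) *
      ((lam + δ - 1) / lam + ⌊y - (k + 1) * ρ⌋ - ⌊y - k * ρ⌋) =
    lam ^ k * shift lam μ δ ⌊y - (k + 1) * ρ⌋ +
      (lam ^ (k + 1) * (scale μ ⌊y - (k + 1) * ρ⌋ + μ ^ (-⌊y - (k + 1) * ρ⌋) * eta lam δ) -
      lam ^ k * (scale μ ⌊y - k * ρ⌋ + μ ^ (-⌊y - k * ρ⌋) * eta lam δ)) := by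
  have hl := h.lam_pos
  have hm := h.mu_pos
  have hy : y - (k + 1) * ρ = y - k * ρ - ρ := by ring
  rw [hy]
  set x := y - k * ρ
  rcases h.floor_sub_rho x with hx | hx
  · rw [hx, shift, eta]
    field_simp
    ring
  · have h1 : scale μ ⌊x⌋ = scale μ (⌊x⌋ - 1) + μ ^ (-(⌊x⌋ - 1)) := by
      rw [← scale_add_one hm, sub_add_cancel]
    have h2 : μ ^ (-(⌊x⌋ - 1)) = μ ^ (-⌊x⌋) * μ := by
      rw [← zpow_add_one₀ hm.ne']; congr 1; ring
    rw [hx, h1, shift, eta, h2]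
    push_cast
    field_simp
    ring

theorem hasSum_phiTerm (h : IrrationalParams lam μ δ ρ) (y : ℝ) :
    HasSum (phiTerm lam μ δ ρ y)
      (μ ^ ⌊y⌋ * (conj lam μ δ ρ y - scale μ ⌊y⌋) - eta lam δ) := by
  have hm := h.mu_pos
  have hw : Summable fun k : ℕ =>
      lam ^ k * (scale μ ⌊y - k * ρ⌋ + μ ^ (-⌊y - k * ρ⌋) * eta lam δ) :=
    ((h.summable_pow_mul_scale y).add
      ((h.summable_pow_mul_zpow_neg_floor y).mul_right (eta lam δ))).congr fun k => by ring
  obtain ⟨W, hW⟩ := hw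
  -- The telescoping part contributes only minus its term at k = 0.
  have h1 := (hasSum_nat_add_iff' 1).2 hW
  have h2 := ((h.hasSum_conj y).add (h1.sub hW)).mul_left (μ ^ ⌊y⌋)
  refine h2.of_eq (fun k => ?_) ?_
  · have h3 := h.pow_mul_zpow_mul_eq y k
    push_cast
    rw [← h3, phiTerm, sub_eq_add_neg ⌊y⌋, zpow_add₀ hm.ne']
    ring
  · simp only [Finset.range_one, Finset.sum_singleton, pow_zero, one_mul, Nat.cast_zero, zero_mul,
      sub_zero, zpow_neg]
    have : μ ^ ⌊y⌋ ≠ 0 := (zpow_pos hm _).ne'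
    field_simp
    ring

theorem phi_eq_conj (h : IrrationalParams lam μ δ ρ) {y : ℝ} (hy : y ∈ Ico (0 : ℝ) 1) :
    phi lam μ δ ρ y = conj lam μ δ ρ y := by
  have h0 : ⌊y⌋ = 0 := Int.floor_eq_zero_iff.2 hy
  rw [phi, (h.hasSum_phiTerm y).tsum_eq, h0, eta]
  simp

/-- Translating by ρ shifts the index by one and frees the term k = 0. -/
theorem conj_add_rho (h : IrrationalParams lam μ δ ρ) (y : ℝ) :
    conj lam μ δ ρ (y + ρ) = lam * conj lam μ δ ρ y + shift lam μ δ ⌊y⌋ := by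
  rw [conj, (h.summable_conj (y + ρ)).tsum_eq_zero_add, conj, ← tsum_mul_left, add_comm]
  congr 1
  · refine tsum_congr fun k => ?_
    rw [show y + ρ - (((k + 1 : ℕ) : ℝ) + 1) * ρ = y - (k + 1) * ρ by push_cast; ring]
    ring
  · simp

theorem conj_add_one (h : IrrationalParams lam μ δ ρ) (y : ℝ) :
    conj lam μ δ ρ (y + 1) = 1 + conj lam μ δ ρ y / μ := by
  have hl : 1 - lam ≠ 0 := by linarith [h.lam_lt_one]
  have h1 := (hasSum_geometric_of_lt_one h.lam_pos.le h.lam_lt_one).mul_right (1 - lam)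
  rw [inv_mul_cancel₀ hl] at h1
  refine HasSum.tsum_eq ?_
  refine (h1.add ((h.hasSum_conj y).div_const μ)).of_eq (fun k => ?_) rfl
  rw [show y + 1 - (k + 1) * ρ = y - (k + 1) * ρ + 1 by ring, Int.floor_add_one,
    shift_add_one h.mu_pos]
  ring

theorem conj_add_intCast (h : IrrationalParams lam μ δ ρ) (m : ℤ) (y : ℝ) :
    conj lam μ δ ρ (y + m) = scale μ m + μ ^ (-m) * conj lam μ δ ρ y := by
  have hm := h.mu_pos
  induction m using Int.induction_on generalizing y with
  | zero => simp
  | succ n ih =>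
    rw [show y + ((n : ℤ) + 1 : ℤ) = (y + 1) + (n : ℤ) by push_cast; ring, ih, h.conj_add_one,
      scale_add_one hm, neg_add, zpow_add₀ hm.ne', zpow_neg_one]
    field_simp
    ring
  | pred n ih =>
    have h1 := ih (y - 1)
    rw [show y - 1 + (-(n : ℤ) : ℤ) = y + (-(n : ℤ) - 1 : ℤ) by push_cast; ring] at h1
    have h2 := h.conj_add_one (y - 1)
    rw [sub_add_cancel] at h2
    have h3 := scale_add_one hm (-(n : ℤ) - 1)
    rw [sub_add_cancel] at h3
    have h4 : μ ^ (-(-(n : ℤ) - 1)) = μ ^ (-(-(n : ℤ))) * μ := by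
      rw [← zpow_add_one₀ hm.ne']; congr 1; ring
    rw [h1, h2, h3, h4]
    field_simp
    ring

/-! ### Monotonicity, one-sided limits and jumps of `conj`. -/

theorem conj_term_mono (h : IrrationalParams lam μ δ ρ) (k : ℕ) :
    Monotone fun y : ℝ => lam ^ k * shift lam μ δ ⌊y - (k + 1) * ρ⌋ := fun _ _ hxy =>
  mul_le_mul_of_nonneg_left (h.strictMono_shift.monotone (Int.floor_mono (by linarith)))
    (pow_nonneg h.lam_pos.le k)

/-- By density some (j+1)ρ + m lies between x and y, and there the j-th term strictly increases. -/
theorem strictMono_conj (h : IrrationalParams lam μ δ ρ) : StrictMono (conj lam μ δ ρ) := by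
  intro x y hxy
  obtain ⟨l, hl, m, hm⟩ := h.irrational.exists_nat_mul_add_int_mem_Ioo hxy 1
  obtain ⟨j, rfl⟩ : ∃ j, l = j + 1 := ⟨l - 1, by omega⟩
  push_cast at hm
  refine Summable.tsum_lt_tsum (i := j) (fun k => h.conj_term_mono k hxy.le) ?_
    (h.summable_conj x) (h.summable_conj y)
  refine mul_lt_mul_of_pos_left (h.strictMono_shift ?_) (pow_pos h.lam_pos j)
  have h1 : ⌊x - (j + 1) * ρ⌋ < m := Int.floor_lt.2 (by linarith [hm.1])
  have h2 : m ≤ ⌊y - (j + 1) * ρ⌋ := Int.le_floor.2 (by linarith [hm.2])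
  omega

/-- Dominated convergence: the terms are monotone, so near y they lie between their values at y - 1
and y + 1. -/
theorem tendsto_conj_aux (h : IrrationalParams lam μ δ ρ) {F : Filter ℝ} {y : ℝ} (hF : F ≤ 𝓝 y)
    (g : ℕ → ℤ) (hg : ∀ k : ℕ, ∀ᶠ x in F, ⌊x - (k + 1) * ρ⌋ = g k) :
    Tendsto (conj lam μ δ ρ) F (𝓝 (∑' k : ℕ, lam ^ k * shift lam μ δ (g k))) := by
  refine tendsto_tsum_of_dominated_convergence
    (bound := fun k : ℕ => |lam ^ k * shift lam μ δ ⌊y - 1 - (k + 1) * ρ⌋| +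
      |lam ^ k * shift lam μ δ ⌊y + 1 - (k + 1) * ρ⌋|)
    ((h.summable_conj (y - 1)).abs.add (h.summable_conj (y + 1)).abs) (fun k => ?_) ?_
  · refine tendsto_const_nhds.congr' ?_
    filter_upwards [hg k] with x hx
    rw [hx]
  · filter_upwards [hF (Icc_mem_nhds (sub_one_lt y) (lt_add_one y))] with x hx k
    have h1 := h.conj_term_mono k hx.1
    have h2 := h.conj_term_mono k hx.2
    simp only at h1 h2
    rw [Real.norm_eq_abs, abs_le]
    constructor
    · linarith [neg_abs_le (lam ^ k * shift lam μ δ ⌊y - 1 - (k + 1) * ρ⌋),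
        abs_nonneg (lam ^ k * shift lam μ δ ⌊y + 1 - (k + 1) * ρ⌋)]
    · linarith [le_abs_self (lam ^ k * shift lam μ δ ⌊y + 1 - (k + 1) * ρ⌋),
        abs_nonneg (lam ^ k * shift lam μ δ ⌊y - 1 - (k + 1) * ρ⌋)]

theorem tendsto_conj_right (h : IrrationalParams lam μ δ ρ) (y : ℝ) :
    Tendsto (conj lam μ δ ρ) (𝓝[≥] y) (𝓝 (conj lam μ δ ρ y)) := by
  refine h.tendsto_conj_aux nhdsWithin_le_nhds _ fun k => ?_
  set c := ((k : ℝ) + 1) * ρ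
  have h1 := Int.lt_floor_add_one (y - c)
  filter_upwards [Ico_mem_nhdsGE (show y < ⌊y - c⌋ + 1 + c by linarith)] with x hx
  rw [Int.floor_eq_iff]
  constructor <;> linarith [hx.1, hx.2, Int.floor_le (y - c)]

theorem tendsto_conj_left (h : IrrationalParams lam μ δ ρ) (y : ℝ) :
    Tendsto (conj lam μ δ ρ) (𝓝[<] y) (𝓝 (conjLeft lam μ δ ρ y)) := by
  refine h.tendsto_conj_aux nhdsWithin_le_nhds _ fun k => ?_
  set c := ((k : ℝ) + 1) * ρ
  have h1 := Int.ceil_lt_add_one (y - c)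
  filter_upwards [Ioo_mem_nhdsLT (show ⌈y - c⌉ - 1 + c < y by linarith)] with x hx
  rw [Int.floor_eq_iff]
  push_cast
  constructor <;> linarith [hx.1, hx.2, Int.le_ceil (y - c)]

theorem conj_lt_conjLeft (h : IrrationalParams lam μ δ ρ) {x y : ℝ} (hxy : x < y) :
    conj lam μ δ ρ x < conjLeft lam μ δ ρ y := by
  obtain ⟨z, hxz, hzy⟩ := exists_between hxy
  refine (h.strictMono_conj hxz).trans_le (ge_of_tendsto (h.tendsto_conj_left y) ?_)
  filter_upwards [Ioo_mem_nhdsLT hzy] with w hw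
  exact h.strictMono_conj.monotone hw.1.le

theorem conjLeft_eq_conj {y : ℝ}
    (hy : ∀ l : ℕ, 1 ≤ l → ∀ m : ℤ, y ≠ l * ρ + m) : conjLeft lam μ δ ρ y = conj lam μ δ ρ y := by
  refine tsum_congr fun k => ?_
  congr 2
  rw [sub_eq_iff_eq_add, Int.ceil_eq_iff]
  have h1 := Int.lt_floor_add_one (y - (k + 1) * ρ)
  have h2 := Int.floor_le (y - (k + 1) * ρ)
  have h3 := hy (k + 1) (by omega) ⌊y - (k + 1) * ρ⌋
  push_cast at h3 ⊢
  refine ⟨?_, h1.le⟩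
  rw [add_sub_cancel_right]
  exact h2.lt_of_ne fun h4 => h3 (by linarith)

/-- Only the j-th term is discontinuous at this point; a second one would make ρ rational. -/
theorem conjLeft_eq_sub (h : IrrationalParams lam μ δ ρ) (j : ℕ) (m : ℤ) :
    conjLeft lam μ δ ρ ((j + 1 : ℕ) * ρ + m) =
      conj lam μ δ ρ ((j + 1 : ℕ) * ρ + m) - lam ^ j * (μ ^ (-m) * jump lam μ δ) := by
  refine HasSum.tsum_eq ?_
  refine ((h.hasSum_conj ((j + 1 : ℕ) * ρ + m)).sub
    (hasSum_ite_eq j (lam ^ j * (μ ^ (-m) * jump lam μ δ)))).of_eq (fun k => ?_) rfl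
  have hx : ((j + 1 : ℕ) : ℝ) * ρ + m - (k + 1) * ρ = ((j : ℤ) - (k : ℤ) : ℤ) * ρ + m := by
    push_cast; ring
  rw [hx]
  split_ifs with hk
  · subst hk
    have h2 := shift_add_one_sub (lam := lam) (δ := δ) h.mu_pos (m - 1)
    rw [sub_add_cancel, show -(m - 1) - 1 = -m by ring] at h2
    simp only [sub_self, Int.cast_zero, zero_mul, zero_add, Int.ceil_intCast, Int.floor_intCast]
    rw [← h2]
    ring
  · have h1 : ((j : ℤ) - (k : ℤ) : ℤ) ≠ 0 := by omega
    have h2 : ⌈((j : ℤ) - (k : ℤ) : ℤ) * ρ + m⌉ - 1 = ⌊((j : ℤ) - (k : ℤ) : ℤ) * ρ + m⌋ := by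
      rw [sub_eq_iff_eq_add, Int.ceil_eq_iff]
      have h3 := Int.lt_floor_add_one (((j : ℤ) - (k : ℤ) : ℤ) * ρ + m)
      have h4 := Int.floor_le (((j : ℤ) - (k : ℤ) : ℤ) * ρ + m)
      have h5 := ((h.irrational.intCast_mul h1).add_intCast m).ne_int
        ⌊((j : ℤ) - (k : ℤ) : ℤ) * ρ + m⌋
      push_cast at h3 h4 h5 ⊢
      refine ⟨?_, h3.le⟩
      rw [add_sub_cancel_right]
      exact h4.lt_of_ne h5.symm
    rw [h2, sub_zero]

theorem intCast_ne_mul_add (h : IrrationalParams lam μ δ ρ) (n : ℤ) (l : ℕ) (hl : 1 ≤ l) (m : ℤ) :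
    (n : ℝ) ≠ l * ρ + m :=
  (((h.irrational.natCast_mul (by omega : l ≠ 0)).add_intCast m).ne_int n).symm

/-! ### The normalization of `conj` and the dynamics of f. -/

/-- The orbit of 0 and conj(nρ) obey the same affine recursion, having equal floors, so their
difference shrinks by λ at each step. -/
theorem coord_iterate_zero (h : IrrationalParams lam μ δ ρ) (n : ℕ) :
    coord μ ((lift lam μ δ)^[n] 0) = conj lam μ δ ρ (n * ρ) - lam ^ n * conj lam μ δ ρ 0 := by
  induction n with
  | zero => simp [coord]
  | succ n ih =>
    rw [Function.iterate_succ_apply', h.coord_lift, ih, h.floor_iterate_zero]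
    have h1 := h.conj_add_rho (n * ρ)
    rw [show (n : ℝ) * ρ + ρ = ((n + 1 : ℕ) : ℝ) * ρ by push_cast; ring] at h1
    rw [h1]
    ring

theorem fract_iterate_zero (h : IrrationalParams lam μ δ ρ) (n : ℕ) :
    Int.fract ((lift lam μ δ)^[n] 0) =
      conj lam μ δ ρ (Int.fract (n * ρ)) - lam ^ n * μ ^ ⌊(n : ℝ) * ρ⌋ * conj lam μ δ ρ 0 := by
  have h1 := h.coord_iterate_zero n
  have h2 := h.conj_add_intCast ⌊(n : ℝ) * ρ⌋ (Int.fract (n * ρ))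
  rw [Int.fract_add_floor] at h2
  rw [coord, h.floor_iterate_zero, h2, zpow_neg] at h1
  have h3 : μ ^ ⌊(n : ℝ) * ρ⌋ ≠ 0 := (zpow_pos h.mu_pos _).ne'
  field_simp at h1
  linarith

/-- The error in `fract_iterate_zero` tends to 0. If conj(0) < 0, times with {lρ} near 0 give a
negative fractional part; if conj(0) > 0, then conj(1⁻) > 1 and times with {lρ} near 1 give one
above 1. -/
theorem conj_zero (h : IrrationalParams lam μ δ ρ) : conj lam μ δ ρ 0 = 0 := by
  have hm := h.mu_pos
  have hlim : Tendsto (fun n : ℕ => lam ^ n * μ ^ ⌊(n : ℝ) * ρ⌋ * conj lam μ δ ρ 0) atTop (𝓝 0) := by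
    simpa using h.summable_pow_mul_zpow_floor.tendsto_atTop_zero.mul_const (conj lam μ δ ρ 0)
  have hfract : ∀ (l : ℕ) (m : ℤ), l * ρ + m ∈ Ioo (0 : ℝ) 1 →
      Int.fract ((l : ℝ) * ρ) = l * ρ + m := fun l m hlm => by
    rw [← Int.fract_add_intCast _ m]
    exact Int.fract_eq_self.2 ⟨hlm.1.le, hlm.2⟩
  rcases lt_trichotomy (conj lam μ δ ρ 0) 0 with hneg | h0 | hpos
  · exfalso
    set s := conj lam μ δ ρ 0 with hs
    have h1 := (h.tendsto_conj_right 0).eventually (gt_mem_nhds (show conj lam μ δ ρ 0 < s / 2 by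
      rw [← hs]; linarith))
    obtain ⟨ε, hε, h2⟩ := mem_nhdsGE_iff_exists_Ico_subset.1 h1
    obtain ⟨N, hN⟩ := eventually_atTop.1 (hlim.eventually (lt_mem_nhds (show s / 2 < 0 by linarith)))
    obtain ⟨l, hl, m, hm1⟩ := h.irrational.exists_nat_mul_add_int_mem_Ioo
      (show (0 : ℝ) < min ε 1 from lt_min hε one_pos) N
    have h3 := hfract l m ⟨hm1.1, hm1.2.trans_le (min_le_right _ _)⟩
    have h4 : conj lam μ δ ρ (l * ρ + m) < s / 2 :=
      h2 ⟨hm1.1.le, hm1.2.trans_le (min_le_left _ _)⟩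
    have h5 := hN l hl
    have h6 := h.fract_iterate_zero l
    rw [h3] at h6
    linarith [Int.fract_nonneg ((lift lam μ δ)^[l] 0)]
  · exact h0
  · exfalso
    set s := conj lam μ δ ρ 0 with hs
    have h1 : conjLeft lam μ δ ρ 1 = 1 + s / μ := by
      rw [conjLeft_eq_conj, ← zero_add (1 : ℝ), h.conj_add_one, zero_add]
      exact_mod_cast h.intCast_ne_mul_add 1
    have hsμ : 0 < s / μ := div_pos hpos hm
    have h2 := (h.tendsto_conj_left 1).eventually (lt_mem_nhds (show 1 + s / μ / 2 <
      conjLeft lam μ δ ρ 1 by linarith))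
    obtain ⟨ε, hε, h3⟩ := mem_nhdsLT_iff_exists_Ioo_subset.1 h2
    obtain ⟨N, hN⟩ := eventually_atTop.1 (hlim.eventually
      (gt_mem_nhds (show 0 < s / μ / 2 by linarith)))
    obtain ⟨l, hl, m, hm1⟩ := h.irrational.exists_nat_mul_add_int_mem_Ioo
      (show max ε 0 < (1 : ℝ) from max_lt hε one_pos) N
    have h4 := hfract l m ⟨(le_max_right _ _).trans_lt hm1.1, hm1.2⟩
    have h5 : 1 + s / μ / 2 < conj lam μ δ ρ (l * ρ + m) :=
      h3 ⟨(le_max_left _ _).trans_lt hm1.1, hm1.2⟩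
    have h6 := hN l hl
    have h7 := h.fract_iterate_zero l
    rw [h4] at h7
    linarith [Int.fract_lt_one ((lift lam μ δ)^[l] 0)]

theorem conj_one (h : IrrationalParams lam μ δ ρ) : conj lam μ δ ρ 1 = 1 := by
  have := h.conj_add_one 0
  rwa [zero_add, h.conj_zero, zero_div, add_zero] at this

theorem conj_mem_Ico (h : IrrationalParams lam μ δ ρ) {y : ℝ} (hy : y ∈ Ico (0 : ℝ) 1) :
    conj lam μ δ ρ y ∈ Ico (0 : ℝ) 1 := by
  constructor
  · rw [← h.conj_zero]; exact h.strictMono_conj.monotone hy.1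
  · rw [← h.conj_one]; exact h.strictMono_conj hy.2

/-- Matches the breakpoint of the rotation with that of f, so both choose the same branch. -/
theorem conj_one_sub_rho (h : IrrationalParams lam μ δ ρ) :
    conj lam μ δ ρ (1 - ρ) = eta lam δ := by
  have h1 := h.conj_add_rho (1 - ρ)
  have h2 : ⌊1 - ρ⌋ = 0 := Int.floor_eq_zero_iff.2
    ⟨by linarith [h.rho_lt_one], by linarith [h.rho_pos]⟩
  rw [sub_add_cancel, h.conj_one, h2, shift_zero] at h1
  rw [eta, eq_div_iff h.lam_pos.ne']
  linarith

/-- `conj` semiconjugates the rotation by `ρ` to `f`. -/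
theorem f_conj (h : IrrationalParams lam μ δ ρ) {y : ℝ} (hy : y ∈ Ico (0 : ℝ) 1) :
    f lam μ δ (conj lam μ δ ρ y) = conj lam μ δ ρ (Int.fract (y + ρ)) := by
  have h1 := h.conj_add_rho y
  rw [Int.floor_eq_zero_iff.2 hy, shift_zero] at h1
  have hr := h.rho_pos
  have hr1 := h.rho_lt_one
  rw [f, ← h.conj_one_sub_rho]
  split_ifs with hlt <;> rw [h.strictMono_conj.lt_iff_lt] at hlt
  · rw [Int.fract_eq_self.2 ⟨by linarith [hy.1], by linarith⟩, h1]
  · have h2 := h.conj_add_one (y + ρ - 1)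
    rw [sub_add_cancel, h1] at h2
    have h3 : Int.fract (y + ρ) = y + ρ - 1 := by
      rw [← Int.fract_sub_one]
      exact Int.fract_eq_self.2 ⟨by linarith, by linarith [hy.2]⟩
    have hm := h.mu_pos
    rw [h3, h2]
    field_simp
    ring

theorem iterate_f_zero (h : IrrationalParams lam μ δ ρ) (l : ℕ) :
    (f lam μ δ)^[l] 0 = conj lam μ δ ρ (Int.fract (l * ρ)) := by
  induction l with
  | zero => simp [h.conj_zero]
  | succ l ih =>
    rw [Function.iterate_succ_apply', ih,
      h.f_conj ⟨Int.fract_nonneg _, Int.fract_lt_one _⟩]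
    congr 1
    rw [Int.fract_eq_fract]
    exact ⟨-⌊(l : ℝ) * ρ⌋, by rw [Int.fract]; push_cast; ring⟩

end IrrationalParams
end TwoIntervalMap

/-! ### The gaps and the iterated images. -/

namespace TwoIntervalMap
namespace IrrationalParams

variable {lam μ δ ρ : ℝ}

theorem fract_mem_Ioo (h : IrrationalParams lam μ δ ρ) {l : ℕ} (hl : 1 ≤ l) :
    Int.fract ((l : ℝ) * ρ) ∈ Ioo (0 : ℝ) 1 := by
  refine ⟨?_, Int.fract_lt_one _⟩
  have := h.floor_lt (n := l) (by omega)
  rw [Int.fract]; linarith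

theorem fract_ne_fract (h : IrrationalParams lam μ δ ρ) {k l : ℕ} (hkl : k ≠ l) :
    Int.fract ((k : ℝ) * ρ) ≠ Int.fract ((l : ℝ) * ρ) := by
  intro heq
  obtain ⟨m, hm⟩ := Int.fract_eq_fract.1 heq
  refine (h.irrational.intCast_mul (m := (k : ℤ) - l) (by omega)).ne_int m ?_
  rw [← hm]; push_cast; ring

theorem fract_ne_one_sub (h : IrrationalParams lam μ δ ρ) (l : ℕ) :
    Int.fract ((l : ℝ) * ρ) ≠ 1 - ρ := by
  intro heq
  rw [Int.fract] at heq
  refine h.natCast_mul_ne_intCast l.succ_ne_zero (⌊(l : ℝ) * ρ⌋ + 1) ?_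
  push_cast; linarith

theorem floor_succ_of_lt (h : IrrationalParams lam μ δ ρ) {l : ℕ}
    (hl : Int.fract ((l : ℝ) * ρ) < 1 - ρ) : ⌊((l + 1 : ℕ) : ℝ) * ρ⌋ = ⌊(l : ℝ) * ρ⌋ := by
  have h1 := Int.floor_add_fract ((l : ℝ) * ρ)
  rw [Int.floor_eq_iff]
  push_cast
  constructor <;> linarith [Int.fract_nonneg ((l : ℝ) * ρ), h.rho_pos]

theorem floor_succ_of_gt (h : IrrationalParams lam μ δ ρ) {l : ℕ}
    (hl : 1 - ρ < Int.fract ((l : ℝ) * ρ)) : ⌊((l + 1 : ℕ) : ℝ) * ρ⌋ = ⌊(l : ℝ) * ρ⌋ + 1 := by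
  have h1 := Int.floor_add_fract ((l : ℝ) * ρ)
  rw [Int.floor_eq_iff]
  push_cast
  constructor <;> linarith [Int.fract_lt_one ((l : ℝ) * ρ), h.rho_lt_one]

theorem xi_eq_conj (h : IrrationalParams lam μ δ ρ) (l : ℕ) :
    xi lam μ δ ρ l = conj lam μ δ ρ (Int.fract (l * ρ)) :=
  h.phi_eq_conj ⟨Int.fract_nonneg _, Int.fract_lt_one _⟩

theorem xi_eq_iterate (h : IrrationalParams lam μ δ ρ) (l : ℕ) :
    xi lam μ δ ρ l = (f lam μ δ)^[l] 0 := by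
  rw [h.xi_eq_conj, h.iterate_f_zero]

theorem tendsto_phi_left (h : IrrationalParams lam μ δ ρ) {y : ℝ} (hy : y ∈ Ioc (0 : ℝ) 1) :
    Tendsto (phi lam μ δ ρ) (𝓝[<] y) (𝓝 (conjLeft lam μ δ ρ y)) := by
  refine (h.tendsto_conj_left y).congr' ?_
  filter_upwards [Ioo_mem_nhdsLT hy.1] with x hx
  exact (h.phi_eq_conj ⟨hx.1.le, hx.2.trans_le hy.2⟩).symm

theorem xiMinus_eq_conjLeft (h : IrrationalParams lam μ δ ρ) {l : ℕ} (hl : 1 ≤ l) :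
    xiMinus lam μ δ ρ l = conjLeft lam μ δ ρ (Int.fract (l * ρ)) :=
  leftLim_eq_of_tendsto
    (h.tendsto_phi_left (Ioo_subset_Ioc_self (h.fract_mem_Ioo hl)))

theorem xiMinus_eq_sub (h : IrrationalParams lam μ δ ρ) {l : ℕ} (hl : 1 ≤ l) :
    xiMinus lam μ δ ρ l = xi lam μ δ ρ l -
      lam ^ (l - 1) * μ ^ ⌊(l : ℝ) * ρ⌋ * jump lam μ δ := by
  obtain ⟨j, rfl⟩ : ∃ j, l = j + 1 := ⟨l - 1, by omega⟩
  have h1 := h.conjLeft_eq_sub j (-⌊((j + 1 : ℕ) : ℝ) * ρ⌋)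
  have h2 : ((j + 1 : ℕ) : ℝ) * ρ + (-⌊((j + 1 : ℕ) : ℝ) * ρ⌋ : ℤ) =
      Int.fract (((j + 1 : ℕ) : ℝ) * ρ) := by
    rw [Int.fract]; push_cast; ring
  rw [h2] at h1
  rw [h.xiMinus_eq_conjLeft hl, h.xi_eq_conj, h1, neg_neg, Nat.add_sub_cancel]
  ring

theorem xiMinus_lt_xi (h : IrrationalParams lam μ δ ρ) {l : ℕ} (hl : 1 ≤ l) :
    xiMinus lam μ δ ρ l < xi lam μ δ ρ l := by
  have : 0 < lam ^ (l - 1) * μ ^ ⌊(l : ℝ) * ρ⌋ * jump lam μ δ :=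
    mul_pos (mul_pos (pow_pos h.lam_pos _) (zpow_pos h.mu_pos _)) h.jump_pos
  rw [h.xiMinus_eq_sub hl]
  linarith

theorem conj_lt_xiMinus (h : IrrationalParams lam μ δ ρ) {l : ℕ} (hl : 1 ≤ l) {y : ℝ}
    (hy : y < Int.fract (l * ρ)) : conj lam μ δ ρ y < xiMinus lam μ δ ρ l := by
  rw [h.xiMinus_eq_conjLeft hl]
  exact h.conj_lt_conjLeft hy

theorem xiMinus_pos (h : IrrationalParams lam μ δ ρ) {l : ℕ} (hl : 1 ≤ l) :
    0 < xiMinus lam μ δ ρ l := by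
  rw [← h.conj_zero]
  exact h.conj_lt_xiMinus hl (h.fract_mem_Ioo hl).1

theorem xi_lt_one (h : IrrationalParams lam μ δ ρ) (l : ℕ) : xi lam μ δ ρ l < 1 := by
  rw [h.xi_eq_conj]
  exact (h.conj_mem_Ico ⟨Int.fract_nonneg _, Int.fract_lt_one _⟩).2

theorem conj_notMem_gap (h : IrrationalParams lam μ δ ρ) {l : ℕ} (hl : 1 ≤ l) (y : ℝ) :
    conj lam μ δ ρ y ∉ Ico (xiMinus lam μ δ ρ l) (xi lam μ δ ρ l) := by
  rintro ⟨h1, h2⟩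
  rw [h.xi_eq_conj, h.strictMono_conj.lt_iff_lt] at h2
  exact (h.conj_lt_xiMinus hl h2).not_ge h1

theorem pairwiseDisjoint_gaps (h : IrrationalParams lam μ δ ρ) :
    (Ici (1 : ℕ)).PairwiseDisjoint fun l => Icc (xiMinus lam μ δ ρ l) (xi lam μ δ ρ l) := by
  have key : ∀ k l : ℕ, 1 ≤ l → Int.fract ((k : ℝ) * ρ) < Int.fract ((l : ℝ) * ρ) →
      Disjoint (Icc (xiMinus lam μ δ ρ k) (xi lam μ δ ρ k))
        (Icc (xiMinus lam μ δ ρ l) (xi lam μ δ ρ l)) := by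
    intro k l hl hkl
    have := h.conj_lt_xiMinus hl hkl
    rw [← h.xi_eq_conj] at this
    exact disjoint_left.2 fun x hx hx' => (hx.2.trans_lt this).not_ge hx'.1
  intro k hk l hl hkl
  rcases (h.fract_ne_fract hkl).lt_or_gt with h1 | h1
  · exact key k l hl h1
  · exact (key l k hk h1).symm

theorem xi_lt_eta (h : IrrationalParams lam μ δ ρ) {l : ℕ}
    (hl : Int.fract ((l : ℝ) * ρ) < 1 - ρ) : xi lam μ δ ρ l < eta lam δ := by
  rw [h.xi_eq_conj, ← h.conj_one_sub_rho]
  exact h.strictMono_conj hl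

theorem eta_lt_xiMinus (h : IrrationalParams lam μ δ ρ) {l : ℕ} (hl1 : 1 ≤ l)
    (hl : 1 - ρ < Int.fract ((l : ℝ) * ρ)) : eta lam δ < xiMinus lam μ δ ρ l := by
  rw [← h.conj_one_sub_rho]
  exact h.conj_lt_xiMinus hl1 hl

theorem f_xi (h : IrrationalParams lam μ δ ρ) (l : ℕ) :
    f lam μ δ (xi lam μ δ ρ l) = xi lam μ δ ρ (l + 1) := by
  rw [h.xi_eq_iterate, h.xi_eq_iterate, Function.iterate_succ_apply']

/-- A gap lies on one side of η, and its length is multiplied by λ on the left or λμ on the right,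
exactly as ⌊lρ⌋ stays or grows by one. -/
theorem f_xiMinus (h : IrrationalParams lam μ δ ρ) {l : ℕ} (hl : 1 ≤ l) :
    f lam μ δ (xiMinus lam μ δ ρ l) = xiMinus lam μ δ ρ (l + 1) := by
  have h1 := h.xiMinus_eq_sub hl
  have h2 := h.xiMinus_lt_xi hl
  have h4 : lam ^ l = lam * lam ^ (l - 1) := by rw [← pow_succ', Nat.sub_add_cancel hl]
  rw [h.xiMinus_eq_sub (Nat.le_add_left 1 l), ← h.f_xi, Nat.add_sub_cancel, h4]
  rcases (h.fract_ne_one_sub l).lt_or_gt with hlt | hgt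
  · have h3 := h.xi_lt_eta hlt
    rw [f, if_pos (h2.trans h3), f, if_pos h3, h.floor_succ_of_lt hlt, h1]
    ring
  · have h3 := h.eta_lt_xiMinus hl hgt
    rw [f, if_neg h3.not_gt, f, if_neg (h3.trans h2).not_gt, h.floor_succ_of_gt hgt, h1,
      zpow_add_one₀ h.mu_pos.ne']
    ring

theorem delta_le_f (h : IrrationalParams lam μ δ ρ) {x : ℝ} (h0 : 0 ≤ x) (hx : x < eta lam δ) :
    δ ≤ f lam μ δ x := by
  rw [f, if_pos hx]
  linarith [mul_nonneg h.lam_pos.le h0]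

theorem f_lt_of_eta_le (h : IrrationalParams lam μ δ ρ) {x : ℝ} (h1 : x < 1)
    (hx : eta lam δ ≤ x) : f lam μ δ x < μ * (lam + δ - 1) := by
  rw [f, if_neg hx.not_gt]
  have := mul_lt_mul_of_pos_left h1 h.lam_pos
  exact mul_lt_mul_of_pos_left (by linarith) h.mu_pos

theorem f_lt_f_iff_of_lt (h : IrrationalParams lam μ δ ρ) {x y : ℝ} (hx : x < eta lam δ)
    (hy : y < eta lam δ) : f lam μ δ x < f lam μ δ y ↔ x < y := by
  rw [f, f, if_pos hx, if_pos hy, add_lt_add_iff_right, mul_lt_mul_iff_right₀ h.lam_pos]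

theorem f_lt_f_iff_of_ge (h : IrrationalParams lam μ δ ρ) {x y : ℝ} (hx : eta lam δ ≤ x)
    (hy : eta lam δ ≤ y) : f lam μ δ x < f lam μ δ y ↔ x < y := by
  rw [f, f, if_neg hx.not_gt, if_neg hy.not_gt, mul_lt_mul_iff_right₀ h.mu_pos,
    sub_lt_sub_iff_right, add_lt_add_iff_right, mul_lt_mul_iff_right₀ h.lam_pos]

/-- On the side of η containing the gap, f is strictly increasing. Points of the other side are sent
across the first gap, to the wrong side of the image. -/
theorem f_mem_gap_iff (h : IrrationalParams lam μ δ ρ) {l : ℕ} (hl : 1 ≤ l) {x : ℝ}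
    (hx : x ∈ Ico (0 : ℝ) 1) :
    f lam μ δ x ∈ Ico (xiMinus lam μ δ ρ (l + 1)) (xi lam μ δ ρ (l + 1)) ↔
      x ∈ Ico (xiMinus lam μ δ ρ l) (xi lam μ δ ρ l) := by
  have hj : μ * (lam + δ - 1) < δ := sub_pos.1 h.jump_pos
  have hlt := h.xiMinus_lt_xi hl
  rw [← h.f_xi, ← h.f_xiMinus hl]
  simp only [mem_Ico, ← not_lt]
  rcases (h.fract_ne_one_sub l).lt_or_gt with hl1 | hl1
  · have h1 := h.xi_lt_eta hl1
    rcases lt_or_ge x (eta lam δ) with h2 | h2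
    · rw [h.f_lt_f_iff_of_lt h2 (hlt.trans h1), h.f_lt_f_iff_of_lt h2 h1]
    · have h3 := h.f_lt_of_eta_le hx.2 h2
      have h4 := h.delta_le_f (h.xiMinus_pos hl).le (hlt.trans h1)
      constructor
      · rintro ⟨h5, -⟩; exact absurd (by linarith) h5
      · rintro ⟨-, h5⟩; exact absurd (h5.trans h1) h2.not_gt
  · have h1 := h.eta_lt_xiMinus hl hl1
    rcases lt_or_ge x (eta lam δ) with h2 | h2
    · have h3 := h.delta_le_f hx.1 h2
      have h4 := h.f_lt_of_eta_le (h.xi_lt_one l) (h1.trans hlt).le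
      constructor
      · rintro ⟨-, h5⟩; linarith
      · rintro ⟨h5, -⟩; exact absurd (h2.trans h1) h5
    · rw [h.f_lt_f_iff_of_ge h2 h1.le, h.f_lt_f_iff_of_ge h2 (h1.trans hlt).le]

theorem xi_one (h : IrrationalParams lam μ δ ρ) : xi lam μ δ ρ 1 = δ := by
  rw [h.xi_eq_iterate, Function.iterate_one, f, if_pos h.eta_pos, mul_zero, zero_add]

theorem xiMinus_one (h : IrrationalParams lam μ δ ρ) :
    xiMinus lam μ δ ρ 1 = μ * (lam + δ - 1) := by
  have h1 : ⌊((1 : ℕ) : ℝ) * ρ⌋ = 0 := by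
    rw [Int.floor_eq_zero_iff]; simp [h.rho_pos.le, h.rho_lt_one]
  rw [h.xiMinus_eq_sub le_rfl, h.xi_one, h1, jump]
  simp

theorem mapsTo_f' (h : IrrationalParams lam μ δ ρ) : MapsTo (f lam μ δ) (Ico 0 1) (Ico 0 1) :=
  mapsTo_f h.lam_pos h.lam_lt_one h.mu_pos h.one_sub_lt h.lt_dBound

theorem image_f (h : IrrationalParams lam μ δ ρ) :
    f lam μ δ '' Ico 0 1 = Ico 0 1 \ Ico (xiMinus lam μ δ ρ 1) (xi lam μ δ ρ 1) := by
  have hl := h.lam_pos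
  have hm := h.mu_pos
  have hη := h.lam_mul_eta
  have hη1 := h.eta_lt_one
  have hη0 := h.eta_pos
  rw [h.xi_one, h.xiMinus_one]
  apply Subset.antisymm
  · rintro _ ⟨x, hx, rfl⟩
    refine ⟨h.mapsTo_f' hx, fun ⟨h1, h2⟩ => ?_⟩
    rcases lt_or_ge x (eta lam δ) with h3 | h3
    · exact (h.delta_le_f hx.1 h3).not_gt h2
    · exact (h.f_lt_of_eta_le hx.2 h3).not_ge h1
  · rintro y ⟨hy, hy1⟩
    rcases lt_or_ge y (μ * (lam + δ - 1)) with h1 | h1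
    · have h2 : y / μ < lam + δ - 1 := by rwa [div_lt_iff₀' hm]
      have h3 : 0 ≤ y / μ := div_nonneg hy.1 hm.le
      have h4 : eta lam δ ≤ (y / μ + 1 - δ) / lam := by
        rw [le_div_iff₀ hl]; linarith
      refine ⟨(y / μ + 1 - δ) / lam, ⟨hη0.le.trans h4, ?_⟩, ?_⟩
      · rw [div_lt_one hl]; linarith
      · rw [f, if_neg h4.not_gt]
        field_simp
        ring
    · have h2 : δ ≤ y := not_lt.1 fun h3 => hy1 ⟨h1, h3⟩
      have h4 : (y - δ) / lam < eta lam δ := by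
        rw [div_lt_iff₀ hl]; linarith [hy.2]
      refine ⟨(y - δ) / lam, ⟨div_nonneg (by linarith) hl.le, h4.trans hη1⟩, ?_⟩
      rw [f, if_pos h4]
      field_simp
      ring

theorem image_iterate_f (h : IrrationalParams lam μ δ ρ) (n : ℕ) :
    (f lam μ δ)^[n] '' Ico 0 1 =
      Ico 0 1 \ ⋃ l ∈ Icc 1 n, Ico (xiMinus lam μ δ ρ l) (xi lam μ δ ρ l) := by
  induction n with
  | zero => simp
  | succ n ih =>
    have himg := h.image_f
    rw [Function.iterate_succ', image_comp, ih]
    ext x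
    simp only [Set.mem_sdiff, mem_iUnion, mem_image, exists_prop, not_exists, not_and]
    constructor
    · rintro ⟨z, ⟨hz, hz1⟩, rfl⟩
      refine ⟨h.mapsTo_f' hz, fun l hl hmem => ?_⟩
      obtain ⟨j, rfl⟩ : ∃ j, l = j + 1 := ⟨l - 1, by have := hl.1; omega⟩
      rcases Nat.eq_zero_or_pos j with rfl | hj
      · exact (himg ▸ mem_image_of_mem (f lam μ δ) hz :
          f lam μ δ z ∈ Ico (0 : ℝ) 1 \ Ico _ _).2 hmem
      · exact hz1 j ⟨hj, by have := hl.2; omega⟩ ((h.f_mem_gap_iff hj hz).1 hmem)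
    · rintro ⟨hx, hx1⟩
      have hx2 : x ∈ f lam μ δ '' Ico 0 1 := by
        rw [himg]
        exact ⟨hx, hx1 1 ⟨le_rfl, by omega⟩⟩
      obtain ⟨z, hz, rfl⟩ := hx2
      refine ⟨z, ⟨hz, fun l hl hmem => ?_⟩, rfl⟩
      exact hx1 (l + 1) ⟨by omega, Nat.succ_le_succ hl.2⟩ ((h.f_mem_gap_iff hl.1 hz).2 hmem)

/-! ### The limit set and its closure. -/

theorem limitSet_eq (h : IrrationalParams lam μ δ ρ) :
    limitSet lam μ δ =
      Ico 0 1 \ ⋃ l ∈ Ici (1 : ℕ), Ico (xiMinus lam μ δ ρ l) (xi lam μ δ ρ l) := by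
  ext x
  simp only [limitSet, h.image_iterate_f, mem_iInter, Set.mem_sdiff, mem_iUnion, exists_prop,
    not_exists, not_and]
  constructor
  · intro hx
    exact ⟨(hx 1 (mem_Ici.2 le_rfl)).1, fun l hl => (hx l hl).2 l ⟨hl, le_rfl⟩⟩
  · rintro ⟨hx, hx1⟩ n -
    exact ⟨hx, fun l hl => hx1 l hl.1⟩

theorem image_phi_eq_image_conj (h : IrrationalParams lam μ δ ρ) :
    phi lam μ δ ρ '' Ico 0 1 = conj lam μ δ ρ '' Ico 0 1 :=
  image_congr fun _ hy => h.phi_eq_conj hy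

theorem image_phi (h : IrrationalParams lam μ δ ρ) :
    phi lam μ δ ρ '' Ico 0 1 =
      Ico 0 1 \ ⋃ l ∈ Ici (1 : ℕ), Ico (xiMinus lam μ δ ρ l) (xi lam μ δ ρ l) := by
  rw [h.image_phi_eq_image_conj]
  apply Subset.antisymm
  · rintro _ ⟨y, hy, rfl⟩
    refine ⟨h.conj_mem_Ico hy, ?_⟩
    simp only [mem_iUnion, exists_prop, not_exists, not_and]
    exact fun l hl => h.conj_notMem_gap hl y
  · rintro x ⟨hx, hx1⟩
    simp only [mem_iUnion, exists_prop, not_exists, not_and] at hx1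
    -- At s = inf A the point x lies between conj(s⁻) and conj(s). Either these agree, or s = {lρ}
    -- and x, not being in the gap, equals conj(s).
    set A : Set ℝ := {y | x < conj lam μ δ ρ y} with hA
    have hne : A.Nonempty := ⟨1, by rw [hA, mem_ofPred_eq, h.conj_one]; exact hx.2⟩
    have hlow : ∀ y ∈ A, 0 ≤ y := fun y hy => by
      by_contra! hy0
      have h1 := h.strictMono_conj hy0
      rw [h.conj_zero] at h1
      exact absurd (hx.1.trans_lt hy) h1.not_gt
    have hbdd : BddBelow A := ⟨0, hlow⟩
    set s := sInf A with hs
    have hs0 : 0 ≤ s := le_csInf hne hlow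
    have hs1 : s ≤ 1 := csInf_le hbdd (by rw [hA, mem_ofPred_eq, h.conj_one]; exact hx.2)
    have hge : x ≤ conj lam μ δ ρ s := by
      refine ge_of_tendsto ((h.tendsto_conj_right s).mono_left
        (nhdsWithin_mono s Ioi_subset_Ici_self)) ?_
      filter_upwards [self_mem_nhdsWithin] with y hy
      obtain ⟨z, hz, hzy⟩ := exists_lt_of_csInf_lt hne hy
      exact (lt_trans hz (h.strictMono_conj hzy)).le
    have hle : conjLeft lam μ δ ρ s ≤ x := by
      refine le_of_tendsto (h.tendsto_conj_left s) ?_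
      filter_upwards [self_mem_nhdsWithin] with y hy
      exact not_lt.1 fun hlt => (csInf_le hbdd hlt).not_gt hy
    have hcont : (∀ l : ℕ, 1 ≤ l → ∀ m : ℤ, s ≠ l * ρ + m) → x = conj lam μ δ ρ s := fun hn => by
      rw [conjLeft_eq_conj hn] at hle
      exact le_antisymm hge hle
    have hlt : s < 1 := hs1.lt_of_ne fun heq => by
      have := hcont (by rw [heq]; exact_mod_cast h.intCast_ne_mul_add 1)
      rw [heq, h.conj_one] at this
      exact hx.2.ne this
    refine ⟨s, ⟨hs0, hlt⟩, ?_⟩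
    by_cases hn : ∀ l : ℕ, 1 ≤ l → ∀ m : ℤ, s ≠ l * ρ + m
    · exact (hcont hn).symm
    · push Not at hn
      obtain ⟨l, hl, m, hm⟩ := hn
      have hfr : Int.fract ((l : ℝ) * ρ) = s := by
        rw [← Int.fract_add_intCast _ m, ← hm]
        exact Int.fract_eq_self.2 ⟨hs0, hlt⟩
      have h1 := hx1 l hl
      rw [h.xi_eq_conj, h.xiMinus_eq_conjLeft hl, hfr, mem_Ico, not_and, not_lt] at h1
      exact le_antisymm (h1 hle) hge

theorem closure_image_phi (h : IrrationalParams lam μ δ ρ) :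
    closure (phi lam μ δ ρ '' Ico 0 1) =
      Icc 0 1 \ ⋃ l ∈ Ici (1 : ℕ), Ioo (xiMinus lam μ δ ρ l) (xi lam μ δ ρ l) := by
  apply Subset.antisymm
  · refine closure_minimal ?_ (isClosed_Icc.sdiff ?_)
    · rw [h.image_phi]
      exact sdiff_subset_sdiff Ico_subset_Icc_self
        (iUnion₂_mono fun l _ => Ioo_subset_Ico_self)
    · exact isOpen_biUnion fun l _ => isOpen_Ioo
  · rintro x ⟨hx, hx1⟩
    have hleft : ∀ y ∈ Ioc (0 : ℝ) 1, conjLeft lam μ δ ρ y ∈ closure (phi lam μ δ ρ '' Ico 0 1) := by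
      intro y hy
      refine mem_closure_of_tendsto (h.tendsto_phi_left hy) ?_
      filter_upwards [Ioo_mem_nhdsLT hy.1] with z hz
      exact mem_image_of_mem _ ⟨hz.1.le, hz.2.trans_le hy.2⟩
    rcases hx.2.eq_or_lt with rfl | hlt
    · have h1 := hleft 1 ⟨one_pos, le_rfl⟩
      rwa [conjLeft_eq_conj (by exact_mod_cast h.intCast_ne_mul_add 1), h.conj_one] at h1
    · by_cases h2 : x ∈ ⋃ l ∈ Ici (1 : ℕ), Ico (xiMinus lam μ δ ρ l) (xi lam μ δ ρ l)
      · simp only [mem_iUnion, exists_prop, not_exists, not_and] at h2 hx1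
        obtain ⟨l, hl, h3⟩ := h2
        have h4 : x = xiMinus lam μ δ ρ l := by
          by_contra hne
          exact hx1 l hl ⟨h3.1.lt_of_ne (Ne.symm hne), h3.2⟩
        rw [h4, h.xiMinus_eq_conjLeft hl]
        exact hleft _ (Ioo_subset_Ioc_self (h.fract_mem_Ioo hl))
      · apply subset_closure
        rw [h.image_phi]
        exact ⟨⟨hx.1, hlt⟩, h2⟩

/-! ### Measure zero and the Cantor structure. -/

/-- Going from 0 to 1 raises every floor in `conj` by one, and the j-th increment is the length of
gap j + 1. -/
theorem hasSum_gaps (h : IrrationalParams lam μ δ ρ) :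
    HasSum (fun j : ℕ => xi lam μ δ ρ (j + 1) - xiMinus lam μ δ ρ (j + 1)) 1 := by
  refine ((h.hasSum_conj (0 + 1)).sub (h.hasSum_conj 0)).of_eq (fun j => ?_) ?_
  · have h1 : ⌊0 + 1 - ((j : ℝ) + 1) * ρ⌋ = ⌊0 - ((j : ℝ) + 1) * ρ⌋ + 1 := by
      rw [← Int.floor_add_one]; congr 1; ring
    have h2 : -⌊0 - ((j : ℝ) + 1) * ρ⌋ - 1 = ⌊((j + 1 : ℕ) : ℝ) * ρ⌋ := by
      rw [zero_sub, Int.floor_neg, neg_neg, sub_eq_iff_eq_add, Int.ceil_eq_iff]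
      have h3 := h.floor_lt j.succ_ne_zero
      have h4 := Int.lt_floor_add_one (((j + 1 : ℕ) : ℝ) * ρ)
      push_cast at h3 h4 ⊢
      exact ⟨by linarith, h4.le⟩
    rw [h.xiMinus_eq_sub (Nat.le_add_left 1 j), h1, ← mul_sub, shift_add_one_sub h.mu_pos, h2,
      Nat.add_sub_cancel]
    ring
  · rw [zero_add, h.conj_one, h.conj_zero, sub_zero]

theorem volume_closure (h : IrrationalParams lam μ δ ρ) :
    volume (closure (phi lam μ δ ρ '' Ico 0 1)) = 0 := by
  have hU : (⋃ l ∈ Ici (1 : ℕ), Ioo (xiMinus lam μ δ ρ l) (xi lam μ δ ρ l)) =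
      ⋃ j : ℕ, Ioo (xiMinus lam μ δ ρ (j + 1)) (xi lam μ δ ρ (j + 1)) := by
    ext x
    simp only [mem_iUnion, exists_prop, mem_Ici]
    constructor
    · rintro ⟨l, hl, hx⟩
      obtain ⟨j, rfl⟩ : ∃ j, l = j + 1 := ⟨l - 1, by omega⟩
      exact ⟨j, hx⟩
    · rintro ⟨j, hx⟩
      exact ⟨j + 1, by omega, hx⟩
  have hvol : volume (⋃ j : ℕ, Ioo (xiMinus lam μ δ ρ (j + 1)) (xi lam μ δ ρ (j + 1))) = 1 := by
    rw [measure_iUnion _ fun j => measurableSet_Ioo]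
    · simp only [Real.volume_Ioo]
      rw [← ENNReal.ofReal_tsum_of_nonneg
        (fun j => sub_nonneg.2 (h.xiMinus_lt_xi (Nat.le_add_left 1 j)).le) h.hasSum_gaps.summable,
        h.hasSum_gaps.tsum_eq, ENNReal.ofReal_one]
    · intro i j hij
      exact (h.pairwiseDisjoint_gaps (mem_Ici.2 (Nat.le_add_left 1 i))
        (mem_Ici.2 (Nat.le_add_left 1 j)) (by omega)).mono Ioo_subset_Icc_self Ioo_subset_Icc_self
  rw [h.closure_image_phi, hU, measure_sdiff _
    (MeasurableSet.iUnion fun j => measurableSet_Ioo).nullMeasurableSet (by simp [hvol]),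
    hvol, Real.volume_Icc]
  · simp
  · refine iUnion_subset fun j x hx => ⟨?_, ?_⟩
    · exact ((h.xiMinus_pos (Nat.le_add_left 1 j)).trans hx.1).le
    · exact (hx.2.trans (h.xi_lt_one _)).le

/-- Right continuity brings values arbitrarily close; strict monotonicity keeps them distinct. -/
theorem preperfect_image_phi (h : IrrationalParams lam μ δ ρ) :
    Preperfect (phi lam μ δ ρ '' Ico 0 1) := by
  rw [h.image_phi_eq_image_conj, preperfect_iff_nhds]
  rintro _ ⟨y, hy, rfl⟩ U hU
  have h1 := (h.tendsto_conj_right y).mono_left (nhdsWithin_mono y Ioi_subset_Ici_self)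
  obtain ⟨z, hz, hzU⟩ := ((show ∀ᶠ z in 𝓝[>] y, z ∈ Ioo y 1 from Ioo_mem_nhdsGT hy.2).and
    (h1.eventually hU)).exists
  exact ⟨_, ⟨hzU, mem_image_of_mem _ ⟨hy.1.trans hz.1.le, hz.2⟩⟩, (h.strictMono_conj hz.1).ne'⟩

theorem nonempty_homeomorph_cantorSet (h : IrrationalParams lam μ δ ρ) :
    Nonempty (closure (phi lam μ δ ρ '' Ico 0 1) ≃ₜ cantorSet) := by
  have hvol := h.volume_closure
  have hK := h.closure_image_phi
  have hperf := h.preperfect_image_phi.perfect_closure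
  have hne : (closure (phi lam μ δ ρ '' Ico 0 1)).Nonempty :=
    ((nonempty_Ico.2 one_pos).image _).closure
  set K := closure (phi lam μ δ ρ '' Ico 0 1)
  have hcomp : IsCompact K := isCompact_Icc.of_isClosed_subset hperf.closed
    (by rw [hK]; exact sdiff_subset)
  have : CompactSpace K := isCompact_iff_compactSpace.1 hcomp
  have : Nonempty K := hne.to_subtype
  have : PerfectSpace K := ⟨by
    rw [preperfect_iff_nhds]
    intro x _ U hU
    obtain ⟨V, hV, hVU⟩ := mem_nhds_subtype _ _ _ |>.1 hU
    obtain ⟨y, hy, hyx⟩ := preperfect_iff_nhds.1 hperf.acc x x.2 V hV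
    exact ⟨⟨y, hy.2⟩, ⟨hVU hy.1, mem_univ _⟩, fun heq => hyx (congrArg Subtype.val heq)⟩⟩
  -- Cutting at a point inside a gap gives a clopen subset of `K`.
  let c : ℕ → ℝ := fun j => (xiMinus lam μ δ ρ (j + 1) + xi lam μ δ ρ (j + 1)) / 2
  have hc : ∀ j, c j ∈ Ioo (xiMinus lam μ δ ρ (j + 1)) (xi lam μ δ ρ (j + 1)) := fun j => by
    have := h.xiMinus_lt_xi (Nat.le_add_left 1 j)
    constructor <;> simp only [c] <;> linarith
  have hnot : ∀ x ∈ K, ∀ j, x ∉ Ioo (xiMinus lam μ δ ρ (j + 1)) (xi lam μ δ ρ (j + 1)) := by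
    intro x hx j hxj
    rw [hK] at hx
    exact hx.2 (mem_biUnion (mem_Ici.2 (Nat.le_add_left 1 j)) hxj)
  have hsep : ∀ x y : K, (x : ℝ) < y → ∃ j, (x : ℝ) < c j ∧ c j < y := by
    intro x y hxy
    -- A null set contains no interval, so a gap lies between x and y.
    have h1 : ¬ Ioo (x : ℝ) y ⊆ K := fun hsub => by
      have h2 := measure_mono_null hsub hvol
      rw [Real.volume_Ioo, ENNReal.ofReal_eq_zero] at h2
      linarith
    obtain ⟨t, ht, htK⟩ := not_subset.1 h1
    have hsub : ∀ z ∈ K, z ∈ Icc (0 : ℝ) 1 := fun z hz => by rw [hK] at hz; exact hz.1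
    have h2 : t ∈ Icc (0 : ℝ) 1 :=
      ⟨(hsub x x.2).1.trans ht.1.le, ht.2.le.trans (hsub y y.2).2⟩
    rw [hK] at htK
    have h3 : t ∈ ⋃ l ∈ Ici (1 : ℕ), Ioo (xiMinus lam μ δ ρ l) (xi lam μ δ ρ l) := by
      by_contra h4
      exact htK ⟨h2, h4⟩
    simp only [mem_iUnion, exists_prop, mem_Ici] at h3
    obtain ⟨l, hl, htl⟩ := h3
    obtain ⟨j, rfl⟩ : ∃ j, l = j + 1 := ⟨l - 1, by omega⟩
    refine ⟨j, ?_, ?_⟩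
    · refine lt_of_le_of_lt (not_lt.1 fun h4 => ?_) (hc j).1
      exact hnot x x.2 j ⟨h4, ht.1.trans htl.2⟩
    · refine lt_of_lt_of_le (hc j).2 (not_lt.1 fun h4 => ?_)
      exact hnot y y.2 j ⟨htl.1.trans ht.2, h4⟩
  obtain ⟨e⟩ := nonempty_homeomorph_nat_bool (X := K) (fun j => {x : K | (x : ℝ) < c j})
    (fun j => by
      refine ⟨?_, isOpen_lt continuous_subtype_val continuous_const⟩
      have h1 : {x : K | (x : ℝ) < c j} = {x : K | (x : ℝ) ≤ c j} := by
        ext x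
        simp only [mem_ofPred_eq]
        refine ⟨fun hx => hx.le, fun hx => hx.lt_of_ne fun heq => ?_⟩
        exact hnot x x.2 j (heq ▸ hc j)
      rw [h1]
      exact isClosed_le continuous_subtype_val continuous_const)
    (fun x y hxy => by
      rcases (Subtype.coe_injective.ne hxy).lt_or_gt with hlt | hlt
      · obtain ⟨j, h1, h2⟩ := hsep x y hlt
        exact ⟨j, fun hiff => h2.not_gt (hiff.1 h1)⟩
      · obtain ⟨j, h1, h2⟩ := hsep y x hlt
        exact ⟨j, fun hiff => h2.not_gt (hiff.2 h1)⟩)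
  exact ⟨e.trans cantorSetHomeomorphNatToBool.symm⟩

/-! ### Explicit orbits of 0 and of 1⁻. -/

/-- Passing to l + 1 multiplies the old terms by λ or λμ, the slope of the branch that f uses at
f^l(0); the new term supplies the translation. -/
theorem iterate_f_zero_eq_sum (h : IrrationalParams lam μ δ ρ) (l : ℕ) :
    (f lam μ δ)^[l] 0 = (1 - δ) / lam +
      ∑ k ∈ Finset.range (l + 1), lam ^ (l - k) * μ ^ (⌊(l : ℝ) * ρ⌋ - ⌊(k : ℝ) * ρ⌋) *
        ((lam + δ - 1) / lam + ⌊((k : ℝ) - 1) * ρ⌋ - ⌊(k : ℝ) * ρ⌋) := by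
  have hl := h.lam_pos
  have hm := h.mu_pos
  induction l with
  | zero =>
    have h1 : ⌊((0 : ℝ) - 1) * ρ⌋ = -1 := by
      rw [Int.floor_eq_iff]
      push_cast
      constructor <;> linarith [h.rho_pos, h.rho_lt_one]
    simp only [zero_add, Finset.range_one, Finset.sum_singleton, Nat.cast_zero, h1,
      Function.iterate_zero, id_eq, zero_mul, Int.floor_zero, sub_self, zpow_zero]
    field_simp
    push_cast
    ring
  | succ l ih =>
    rw [Finset.sum_range_succ]
    have hstep : ∀ k ∈ Finset.range (l + 1),
        lam ^ (l + 1 - k) * μ ^ (⌊((l + 1 : ℕ) : ℝ) * ρ⌋ - ⌊(k : ℝ) * ρ⌋) *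
          ((lam + δ - 1) / lam + ⌊((k : ℝ) - 1) * ρ⌋ - ⌊(k : ℝ) * ρ⌋) =
        lam * μ ^ (⌊((l + 1 : ℕ) : ℝ) * ρ⌋ - ⌊(l : ℝ) * ρ⌋) *
        (lam ^ (l - k) * μ ^ (⌊(l : ℝ) * ρ⌋ - ⌊(k : ℝ) * ρ⌋) *
          ((lam + δ - 1) / lam + ⌊((k : ℝ) - 1) * ρ⌋ - ⌊(k : ℝ) * ρ⌋)) := by
      intro k hk
      rw [Finset.mem_range] at hk
      rw [show l + 1 - k = (l - k) + 1 by omega, pow_succ,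
        show ⌊((l + 1 : ℕ) : ℝ) * ρ⌋ - ⌊(k : ℝ) * ρ⌋ =
          (⌊((l + 1 : ℕ) : ℝ) * ρ⌋ - ⌊(l : ℝ) * ρ⌋) + (⌊(l : ℝ) * ρ⌋ - ⌊(k : ℝ) * ρ⌋) by ring,
        zpow_add₀ hm.ne']
      ring
    rw [Finset.sum_congr rfl hstep, ← Finset.mul_sum, Function.iterate_succ_apply',
      show (((l + 1 : ℕ) : ℝ) - 1) * ρ = l * ρ by push_cast; ring]
    have hX : ∑ k ∈ Finset.range (l + 1), lam ^ (l - k) *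
        μ ^ (⌊(l : ℝ) * ρ⌋ - ⌊(k : ℝ) * ρ⌋) *
        ((lam + δ - 1) / lam + ⌊((k : ℝ) - 1) * ρ⌋ - ⌊(k : ℝ) * ρ⌋) =
        (f lam μ δ)^[l] 0 - (1 - δ) / lam := by linarith
    rw [hX, Nat.sub_self, sub_self, pow_zero, zpow_zero, ← h.xi_eq_iterate]
    rcases (h.fract_ne_one_sub l).lt_or_gt with hlt | hgt
    · rw [f, if_pos (h.xi_lt_eta hlt), h.floor_succ_of_lt hlt, sub_self, zpow_zero]
      field_simp
      ring
    · have h1 : ¬ xi lam μ δ ρ l < eta lam δ := by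
        rw [h.xi_eq_conj, ← h.conj_one_sub_rho, h.strictMono_conj.lt_iff_lt]
        exact hgt.not_gt
      rw [f, if_neg h1, h.floor_succ_of_gt hgt, add_sub_cancel_left, zpow_one]
      field_simp
      push_cast
      ring

theorem continuousAt_f {x : ℝ} (hx : x ≠ eta lam δ) : ContinuousAt (f lam μ δ) x := by
  rcases hx.lt_or_gt with hlt | hgt
  · refine ContinuousAt.congr (f := fun x => lam * x + δ) (by fun_prop) ?_
    filter_upwards [Iio_mem_nhds hlt] with y hy
    rw [f, if_pos (mem_Iio.1 hy)]
  · refine ContinuousAt.congr (f := fun x => μ * (lam * x + δ - 1)) (by fun_prop) ?_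
    filter_upwards [Ioi_mem_nhds hgt] with y hy
    rw [f, if_neg (mem_Ioi.1 hy).not_gt]

theorem tendsto_iterate_f_left (h : IrrationalParams lam μ δ ρ) {l : ℕ} (hl : 1 ≤ l) :
    Tendsto ((f lam μ δ)^[l]) (𝓝[<] 1) (𝓝 (xiMinus lam μ δ ρ l)) := by
  induction l, hl using Nat.le_induction with
  | base =>
    -- The second affine formula for `f` extends past 1, so the left limit at 1 is its value there.
    have h1 := (continuousAt_f (μ := μ) h.eta_lt_one.ne').tendsto.mono_left
      (nhdsWithin_le_nhds (s := Iio 1))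
    rw [f, if_neg h.eta_lt_one.not_gt, mul_one, ← h.xiMinus_one] at h1
    simpa using h1
  | succ l hl ih =>
    have hne : xiMinus lam μ δ ρ l ≠ eta lam δ := by
      rcases (h.fract_ne_one_sub l).lt_or_gt with hlt | hgt
      · exact ((h.xiMinus_lt_xi hl).trans (h.xi_lt_eta hlt)).ne
      · exact (h.eta_lt_xiMinus hl hgt).ne'
    rw [Function.iterate_succ', ← h.f_xiMinus hl]
    exact (continuousAt_f hne).tendsto.comp ih

end IrrationalParams
end TwoIntervalMap

theorem proposition5 (lam μ δ ρ : ℝ) (hlam0 : 0 < lam) (hlam1 : lam < 1) (hμ : 0 < μ)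
    (hδ1 : 1 - lam < δ) (hδ2 : δ < TwoIntervalMap.dBound lam μ)
    (hρ : ρ = TwoIntervalMap.rotationNumber lam μ δ) (hirr : Irrational ρ) :
    -- the series defining `φ` converges, and the left limits `ξ_l⁻` exist
    (∀ y : ℝ, Summable (TwoIntervalMap.phiTerm lam μ δ ρ y)) ∧
    (∀ l : ℕ, 1 ≤ l → Tendsto (TwoIntervalMap.phi lam μ δ ρ) (𝓝[<] (Int.fract (l * ρ)))
      (𝓝 (TwoIntervalMap.xiMinus lam μ δ ρ l))) ∧
    -- the intervals are nondegenerate, contained in `(0, 1)` and pairwise disjoint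
    (∀ l : ℕ, 1 ≤ l → 0 < TwoIntervalMap.xiMinus lam μ δ ρ l ∧
      TwoIntervalMap.xiMinus lam μ δ ρ l < TwoIntervalMap.xi lam μ δ ρ l ∧
      TwoIntervalMap.xi lam μ δ ρ l < 1) ∧
    (Ici (1 : ℕ)).PairwiseDisjoint (fun l =>
      Icc (TwoIntervalMap.xiMinus lam μ δ ρ l) (TwoIntervalMap.xi lam μ δ ρ l)) ∧
    -- the iterated images
    (∀ n : ℕ, 1 ≤ n → (TwoIntervalMap.f lam μ δ)^[n] '' Ico 0 1 =
      Ico 0 1 \ ⋃ l ∈ Icc 1 n,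
        Ico (TwoIntervalMap.xiMinus lam μ δ ρ l) (TwoIntervalMap.xi lam μ δ ρ l)) ∧
    -- `ξ_l = f^l(0)` and its explicit value
    (∀ l : ℕ, 1 ≤ l →
      TwoIntervalMap.xi lam μ δ ρ l = (TwoIntervalMap.f lam μ δ)^[l] 0 ∧
      (TwoIntervalMap.f lam μ δ)^[l] 0 = (1 - δ) / lam +
        ∑ k ∈ Finset.range (l + 1), lam ^ (l - k) * μ ^ (⌊(l : ℝ) * ρ⌋ - ⌊(k : ℝ) * ρ⌋) *
          ((lam + δ - 1) / lam + ⌊((k : ℝ) - 1) * ρ⌋ - ⌊(k : ℝ) * ρ⌋)) ∧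
    -- `ξ_l⁻ = f^l(1⁻)` and its explicit value
    (∀ l : ℕ, 1 ≤ l →
      Tendsto ((TwoIntervalMap.f lam μ δ)^[l]) (𝓝[<] 1)
        (𝓝 (TwoIntervalMap.xiMinus lam μ δ ρ l)) ∧
      TwoIntervalMap.xiMinus lam μ δ ρ l = (TwoIntervalMap.f lam μ δ)^[l] 0 -
        lam ^ (l - 1) * μ ^ ⌊(l : ℝ) * ρ⌋ * (δ - μ * (lam + δ - 1))) ∧
    -- the limit set and its closure
    TwoIntervalMap.limitSet lam μ δ = TwoIntervalMap.phi lam μ δ ρ '' Ico 0 1 ∧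
    TwoIntervalMap.phi lam μ δ ρ '' Ico 0 1 =
      Ico 0 1 \ ⋃ l ∈ Ici (1 : ℕ),
        Ico (TwoIntervalMap.xiMinus lam μ δ ρ l) (TwoIntervalMap.xi lam μ δ ρ l) ∧
    closure (TwoIntervalMap.limitSet lam μ δ) =
      closure (TwoIntervalMap.phi lam μ δ ρ '' Ico 0 1) ∧
    closure (TwoIntervalMap.phi lam μ δ ρ '' Ico 0 1) =
      Icc 0 1 \ ⋃ l ∈ Ici (1 : ℕ),
        Ioo (TwoIntervalMap.xiMinus lam μ δ ρ l) (TwoIntervalMap.xi lam μ δ ρ l) ∧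
    -- the closure is a Lebesgue-null Cantor set
    volume (closure (TwoIntervalMap.limitSet lam μ δ)) = 0 ∧
    Nonempty (closure (TwoIntervalMap.limitSet lam μ δ) ≃ₜ cantorSet) := by
  have h : TwoIntervalMap.IrrationalParams lam μ δ ρ :=
    ⟨hlam0, hlam1, hμ, hδ1, hδ2, hρ, hirr⟩
  have hset : TwoIntervalMap.limitSet lam μ δ = TwoIntervalMap.phi lam μ δ ρ '' Ico 0 1 :=
    h.limitSet_eq.trans h.image_phi.symm
  refine ⟨fun y => (h.hasSum_phiTerm y).summable, fun l hl => ?_,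
    fun l hl => ⟨h.xiMinus_pos hl, h.xiMinus_lt_xi hl, h.xi_lt_one l⟩, h.pairwiseDisjoint_gaps,
    fun n _ => h.image_iterate_f n, fun l _ => ⟨h.xi_eq_iterate l, h.iterate_f_zero_eq_sum l⟩,
    fun l hl => ⟨h.tendsto_iterate_f_left hl, ?_⟩, hset, h.image_phi, congrArg closure hset,
    h.closure_image_phi, ?_, ?_⟩
  · rw [h.xiMinus_eq_conjLeft hl]
    exact h.tendsto_phi_left (Ioo_subset_Ioc_self (h.fract_mem_Ioo hl))
  · rw [← h.xi_eq_iterate]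
    exact h.xiMinus_eq_sub hl
  · rw [hset]
    exact h.volume_closure
  · rw [hset]
    exact h.nonempty_homeomorph_cantorSet
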